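/- Let $m\in\mathbb N$. There is a constant $K_m\in(0,\infty)$, depending only on $m$, with the following property. Let $n\in\mathbb N$ and $p>1$, let $X_i^{(j)}$, $1\le i\le n$, $1\le j\le m$, be independent random variables (not necessarily identically distributed) with values in a measurable space $(S,\mathcal S)$, and for every $\mathbf i=(i_1,\dots,i_m)\in\{1,\dots,n\}^m$ let $h_{\mathbf i}:S^m\to[0,\infty)$ be a measurable function whose $p$-th power is integrable for the law of $(X_{i_1}^{(1)},\dots,X_{i_m}^{(m)})$. Write $h_{\mathbf i}$ also for the random variable $h_{\mathbf i}(X_{i_1}^{(1)},\dots,X_{i_m}^{(m)})$, put $A=\sum_{\mathbf i}h_{\mathbf i}$ (sum over all $\mathbf i\in\{1,\dots,n\}^m$), and let $$t_0=\inf\Bigl\{t\ge 0:\Pr\{A>t\}\le \frac{1}{2^{(p+1)/(p-1)}K_m^{p/(p-1)}}\Bigr\}.$$ For $J\subseteq\{1,\dots,m\}$ with complement $J^c$, let $\mathbf i_J=(i_j)_{j\in J}$, let $\sum_{\mathbf i_{J^c}}$ denote the sum over all values in $\{1,\dots,n\}$ of the indices $i_j$, $j\in J^c$, and let $E_J$ denote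 expectation with respect to the variables $X_i^{(j)}$, $j\in J$, $1\le i\le n$, only (for $J^c=\emptyset$ the operations $\sum_{\mathbf i_{J^c}}$ and $E_{J^c}$ are the identity). Then $$\max\Bigl\{\frac{t_0^p}{(4K_m)^{p/(p-1)}},\ \max_{\emptyset\ne J\subseteq\{1,\dots,m\}}E_J\max_{\mathbf i_J}\Bigl(\sum_{\mathbf i_{J^c}}E_{J^c}h_{\mathbf i}\Bigr)^p\Bigr\}\ \le\ E\Bigl(\sum_{\mathbf i}h_{\mathbf i}\Bigr)^p$$ and $$E\Bigl(\sum_{\mathbf i}h_{\mathbf i}\Bigr)^p\ \le\ (4K_m)^p\Bigl\{2^{1+p}t_0^p+\sum_{\emptyset\ne J\subseteq\{1,\dots,m\}}p^{|J|p}\,E_J\max_{\mathbf i_J}\Bigl(\sum_{\mathbf i_{J^c}}E_{J^c}h_{\mathbf i}\Bigr)^p\Bigr\}.$$ -/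

import Mathlib

open MeasureTheory ProbabilityTheory

universe u v

namespace UStat

noncomputable section

variable {Ω : Type u} {S : Type v} {m n : ℕ}

/-- The point `(x_{i_1}^{(1)}, …, x_{i_m}^{(m)})` of `S^m` selected by the multi-index `i` from an
array `x`, whose entry at `(j, k)` stands for `x_k^{(j)}`. -/
def select (i : Fin m → Fin n) (x : Fin m × Fin n → S) : Fin m → S :=
  fun j => x (j, i j)

/-- The generalized decoupled U-statistic `A = ∑_i h_i(X_{i_1}^{(1)}, …, X_{i_m}^{(m)})`, where
`X (j, k)` is the random variable `X_k^{(j)}`. -/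
def stat (h : (Fin m → Fin n) → (Fin m → S) → ℝ) (X : Fin m × Fin n → Ω → S) (ω : Ω) : ℝ :=
  ∑ i : Fin m → Fin n, h i (select i fun a => X a ω)

/-- Level of the quantile: `1 / (2^{(p+1)/(p-1)} K^{p/(p-1)})`. -/
def level (K p : ℝ) : ℝ :=
  1 / ((2 : ℝ) ^ ((p + 1) / (p - 1)) * K ^ (p / (p - 1)))

/-- `t₀ = inf {t ≥ 0 : P(A > t) ≤ level K p}`. -/
def quantile [MeasurableSpace Ω] (P : Measure Ω) (A : Ω → ℝ) (K p : ℝ) : ℝ :=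
  sInf {t : ℝ | 0 ≤ t ∧ P {ω | t < A ω} ≤ ENNReal.ofReal (level K p)}

/-- `E_J F`: expectation of a nonnegative function `F` of the array with respect to the variables
`X_k^{(j)}`, `j ∈ J`, `k = 1, …, n`, only. These variables are integrated out with respect to the
product of their laws, and the result is a function of the values `x` of the array (which depends
only on the entries of `x` with `j ∉ J`). -/
def partialE [MeasurableSpace Ω] [MeasurableSpace S] (P : Measure Ω) (X : Fin m × Fin n → Ω → S)
    (J : Finset (Fin m)) (F : (Fin m × Fin n → S) → ENNReal) : (Fin m × Fin n → S) → ENNReal :=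
  lmarginal (fun a => P.map (X a)) (J ×ˢ (Finset.univ : Finset (Fin n))) F

/-- `∑_{i_{Jᶜ}} E_{Jᶜ} h_i` for a given value `a` of `i_J`: the sum runs over the multi-indices `i`
whose restriction `i_J` to the places in `J` is `a`. -/
def innerSum [MeasurableSpace Ω] [MeasurableSpace S] (P : Measure Ω) (X : Fin m × Fin n → Ω → S)
    (h : (Fin m → Fin n) → (Fin m → S) → ℝ) (J : Finset (Fin m)) (a : J → Fin n)
    (x : Fin m × Fin n → S) : ENNReal :=
  ∑ i : Fin m → Fin n with J.restrict i = a,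
    partialE P X Jᶜ (fun y => ENNReal.ofReal (h i (select i y))) x

/-- `E_J max_{i_J} (∑_{i_{Jᶜ}} E_{Jᶜ} h_i)^p`. The maximum is a function of the variables
`X_k^{(j)}` with `j ∈ J` only, so that its `E_J` is its expectation. -/
def maxMoment [MeasurableSpace Ω] [MeasurableSpace S] (P : Measure Ω) (X : Fin m × Fin n → Ω → S)
    (h : (Fin m → Fin n) → (Fin m → S) → ℝ) (p : ℝ) (J : Finset (Fin m)) : ENNReal :=
  ∫⁻ ω, ⨆ a : J → Fin n, (innerSum P X h J a fun b => X b ω) ^ p ∂P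

end

end UStat

namespace UStat

open scoped ENNReal

/-! ### Moment inequalities for sums of independent nonnegative variables -/

section OneSample

variable {Ω : Type*} [MeasurableSpace Ω] {P : Measure Ω}

/-! The lower bound is soft. Markov's inequality for `A ^ p` bounds `t₀`. For each `J`, the inner
sums are at most the conditional expectation of `A` given the groups in `J`, so Jensen's inequality
bounds their maximal `p`-th moment (`maxMoment_le`).

The upper bound is first proved with `(E A)^p`, the term `J = ∅`, in place of the term in `t₀`, by
induction on the number of groups. Given the other groups, `A` is a sum over `k` of variables `B_k`
that are independent through group `j`. Rosenthal's inequality (`lintegral_sum_rpow_le`) leaves the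
statistic with group `j` integrated out, and `p^p ∑ E B_k^p`. The induction hypothesis applies to
both; in the second it produces sums over `k` of moments of conditional maxima, where a maximum over
`k` is wanted. The comparison `rpow_mul_sum_lintegral_rpow_le` trades these sums for the maximum
plus the `p`-th power of a mean, and that power is absorbed by the statistic with `j` integrated
out. It is essential that no power of `p` beyond `C^p` falls on this mean: otherwise the weights
`p^{|J|p}` would grow along the induction.

Finally Hölder's inequality on `{A > t₀}` gives `E A ≤ t₀ + (E A^p)^{1/p} level^{1-1/p}`. The level
is tuned so that the resulting multiple of `E A^p` is `1/4`, which finiteness allows to be absorbed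
on the left. -/

theorem lintegral_rpow_le_rpow_lintegral [IsProbabilityMeasure P] {f : Ω → ℝ≥0∞}
    (hf : Measurable f) {r : ℝ} (h0 : 0 ≤ r) (h1 : r ≤ 1) :
    ∫⁻ ω, f ω ^ r ∂P ≤ (∫⁻ ω, f ω ∂P) ^ r := by
  simpa using ENNReal.lintegral_mul_norm_pow_le (μ := P) hf.aemeasurable
    (g := fun _ => 1) aemeasurable_const h0 (sub_nonneg.2 h1) (by ring)

theorem rpow_lintegral_le_lintegral_rpow [IsProbabilityMeasure P] {f : Ω → ℝ≥0∞}
    (hf : Measurable f) {p : ℝ} (hp : 1 ≤ p) :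
    (∫⁻ ω, f ω ∂P) ^ p ≤ ∫⁻ ω, f ω ^ p ∂P := by
  have hp0 : 0 < p := by linarith
  have h := lintegral_rpow_le_rpow_lintegral (P := P) (hf.pow_const p) (r := p⁻¹)
    (by positivity) (inv_le_one_of_one_le₀ hp)
  simp only [ENNReal.rpow_rpow_inv hp0.ne'] at h
  calc _ ≤ _ := ENNReal.rpow_le_rpow h hp0.le
    _ = _ := ENNReal.rpow_inv_rpow hp0.ne' _

theorem mul_rpow_sub_one (x : ℝ≥0∞) {p : ℝ} (hp : 1 ≤ p) : x * x ^ (p - 1) = x ^ p := by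
  conv_lhs => enter [1]; rw [← ENNReal.rpow_one x]
  rw [← ENNReal.rpow_add_of_nonneg _ _ zero_le_one (sub_nonneg.2 hp)]
  congr 1; ring

/-- The coefficient of `a ^ (p - 1)` must stay bounded in `p`. If `p b ≤ a`, then `(1 + 1/p)^(p-1) ≤
e ≤ 3`; otherwise `a + b ≤ 2 p b`, and the whole cost in `p` falls on `b`. -/
theorem add_rpow_sub_one_le (a b : ℝ≥0∞) {p : ℝ} (hp : 1 ≤ p) :
    (a + b) ^ (p - 1) ≤
      3 * a ^ (p - 1) + (2 * ENNReal.ofReal p) ^ (p - 1) * b ^ (p - 1) := by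
  have hp0 : 0 < p := by linarith
  have hr : 0 ≤ p - 1 := by linarith
  have hP1 : 1 ≤ ENNReal.ofReal p := by simpa using hp
  rcases le_total (ENNReal.ofReal p * b) a with h | h
  · refine le_trans ?_ le_self_add
    have hb : b ≤ ENNReal.ofReal p⁻¹ * a := by
      calc b = ENNReal.ofReal p⁻¹ * (ENNReal.ofReal p * b) := by
            rw [← mul_assoc, ← ENNReal.ofReal_mul (by positivity), inv_mul_cancel₀ hp0.ne']; simp
        _ ≤ _ := by gcongr
    have hab : a + b ≤ ENNReal.ofReal (1 + p⁻¹) * a := by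
      rw [ENNReal.ofReal_add zero_le_one (by positivity), add_mul]
      simpa using add_le_add_right hb a
    refine (ENNReal.rpow_le_rpow hab hr).trans ?_
    rw [ENNReal.mul_rpow_of_nonneg _ _ hr, ENNReal.ofReal_rpow_of_pos (by positivity)]
    gcongr
    rw [show (3 : ℝ≥0∞) = ENNReal.ofReal 3 by simp]
    refine ENNReal.ofReal_le_ofReal ?_
    calc (1 + p⁻¹) ^ (p - 1) ≤ (Real.exp p⁻¹) ^ (p - 1) := by
          refine Real.rpow_le_rpow (by positivity) ?_ hr
          linarith [Real.add_one_le_exp p⁻¹]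
      _ = Real.exp (p⁻¹ * (p - 1)) := (Real.exp_mul _ _).symm
      _ ≤ Real.exp 1 := by
          refine Real.exp_le_exp.2 ?_
          rw [mul_sub, inv_mul_cancel₀ hp0.ne']
          have : 0 ≤ p⁻¹ := by positivity
          linarith
      _ ≤ 3 := Real.exp_one_lt_d9.le.trans (by norm_num)
  · refine le_trans ?_ le_add_self
    rw [← ENNReal.mul_rpow_of_nonneg _ _ hr]
    refine ENNReal.rpow_le_rpow ?_ hr
    calc a + b ≤ ENNReal.ofReal p * b + ENNReal.ofReal p * b := by
          gcongr
          exact le_mul_of_one_le_left zero_le hP1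
      _ = _ := by ring

/-- Solves a self-bounding inequality: whichever summand is larger carries at least half of `u`.
Dividing by `u ^ (1 - p⁻¹)` is where finiteness enters. -/
theorem le_of_le_mul_rpow_add {u a R : ℝ≥0∞} {p : ℝ} (hp : 1 ≤ p) (hu : u ≠ ∞)
    (h : u ≤ a * u ^ (1 - p⁻¹) + R) : u ≤ (2 * a) ^ p + 2 * R := by
  have hp0 : 0 < p := by linarith
  rcases le_total (a * u ^ (1 - p⁻¹)) R with h' | h'
  · refine le_trans ?_ le_add_self
    calc u ≤ R + R := h.trans (by gcongr)
      _ = _ := by ring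
  · refine le_trans ?_ le_self_add
    rcases eq_or_ne u 0 with rfl | hu0
    · simp
    have h2 : u ≤ 2 * a * u ^ (1 - p⁻¹) := by
      calc u ≤ a * u ^ (1 - p⁻¹) + a * u ^ (1 - p⁻¹) := h.trans (by gcongr)
        _ = _ := by ring
    have h3 : u ^ p⁻¹ * u ^ (1 - p⁻¹) = u := by
      rw [← ENNReal.rpow_add _ _ hu0 hu]; simp
    have h4 : u ^ p⁻¹ ≤ 2 * a := by
      have h4 : u ^ p⁻¹ * u ^ (1 - p⁻¹) ≤ 2 * a * u ^ (1 - p⁻¹) := h3.le.trans h2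
      refine (ENNReal.mul_le_mul_iff_left ?_ ?_).1 h4
      · simp [ENNReal.rpow_eq_zero_iff, hu0, hu]
      · simp [ENNReal.rpow_eq_top_iff, hu0, hu]
    calc u = (u ^ p⁻¹) ^ p := (ENNReal.rpow_inv_rpow hp0.ne' _).symm
      _ ≤ _ := ENNReal.rpow_le_rpow h4 hp0.le

variable {ι : Type*} [Fintype ι]

/-- Rosenthal's inequality for nonnegative variables, with constants uniform in `p`. -/
theorem lintegral_sum_rpow_le [IsProbabilityMeasure P] {ξ : ι → Ω → ℝ≥0∞} (hm : ∀ k, Measurable (ξ k))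
    (hi : iIndepFun ξ P) {p : ℝ} (hp : 1 < p) :
    ∫⁻ ω, (∑ k, ξ k ω) ^ p ∂P ≤ 6 ^ p *
      ((∑ k, ∫⁻ ω, ξ k ω ∂P) ^ p +
        ENNReal.ofReal p ^ p * ∑ k, ∫⁻ ω, ξ k ω ^ p ∂P) := by
  classical
  have hp0 : 0 < p := by linarith
  have hr : 0 ≤ p - 1 := by linarith
  have hP1 : 1 ≤ ENNReal.ofReal p := by simpa using hp.le
  by_cases htop : ∃ k, ∫⁻ ω, ξ k ω ^ p ∂P = ∞
  · obtain ⟨k, hk⟩ := htop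
    have h1 : ∑ k, ∫⁻ ω, ξ k ω ^ p ∂P = ∞ := ENNReal.sum_eq_top.2 ⟨k, Finset.mem_univ _, hk⟩
    have h2 : ENNReal.ofReal p ^ p ≠ 0 := by
      simp [ENNReal.rpow_eq_zero_iff, hp0, hp0.not_gt]
    have h3 : (6 : ℝ≥0∞) ^ p ≠ 0 := by simp [ENNReal.rpow_eq_zero_iff]
    rw [h1, ENNReal.mul_top h2, add_top, ENNReal.mul_top h3]
    exact le_top
  push Not at htop
  have hSm : Measurable fun ω => ∑ k, ξ k ω := by fun_prop
  set u := ∫⁻ ω, (∑ k, ξ k ω) ^ p ∂P with hu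
  have hutop : u ≠ ∞ := by
    refine ne_top_of_le_ne_top ?_ (lintegral_mono fun ω =>
      ENNReal.rpow_sum_le_const_mul_sum_rpow Finset.univ (fun k => ξ k ω) hp.le)
    rw [lintegral_const_mul _ (by fun_prop), lintegral_finsetSum _ (fun k _ => by fun_prop)]
    refine ENNReal.mul_ne_top (ENNReal.rpow_ne_top_of_nonneg hr (by simp)) ?_
    exact ENNReal.sum_ne_top.2 fun k _ => htop k
  have hterm : ∀ k, ∫⁻ ω, ξ k ω * (∑ l, ξ l ω) ^ (p - 1) ∂P ≤
      3 * ((∫⁻ ω, ξ k ω ∂P) * u ^ (1 - p⁻¹)) +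
        (2 * ENNReal.ofReal p) ^ (p - 1) * ∫⁻ ω, ξ k ω ^ p ∂P := by
    intro k
    -- Leaving out the `k`-th variable makes the remaining sum independent of it.
    have hind : ∫⁻ ω, ξ k ω * (∑ l ∈ Finset.univ.erase k, ξ l ω) ^ (p - 1) ∂P =
        (∫⁻ ω, ξ k ω ∂P) * ∫⁻ ω, (∑ l ∈ Finset.univ.erase k, ξ l ω) ^ (p - 1) ∂P := by
      have h := (hi.indepFun_finsetSum_of_notMem hm (Finset.notMem_erase k Finset.univ)).symm
      have h' := h.comp (φ := id) (ψ := fun x => x ^ (p - 1)) measurable_id (by fun_prop)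
      have := lintegral_mul_eq_lintegral_mul_lintegral_of_indepFun (μ := P)
        (f := ξ k) (g := fun ω => (∑ l ∈ Finset.univ.erase k, ξ l ω) ^ (p - 1))
        (hm k) (by fun_prop) (by simpa [Function.comp_def, Finset.sum_apply] using h')
      simpa using this
    have hle : ∫⁻ ω, (∑ l ∈ Finset.univ.erase k, ξ l ω) ^ (p - 1) ∂P ≤ u ^ (1 - p⁻¹) := by
      calc _ ≤ ∫⁻ ω, ((∑ l, ξ l ω) ^ p) ^ (1 - p⁻¹) ∂P := by
            refine lintegral_mono fun ω => ?_
            rw [← ENNReal.rpow_mul, mul_sub, mul_one, mul_inv_cancel₀ hp0.ne']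
            refine ENNReal.rpow_le_rpow ?_ hr
            exact Finset.sum_le_sum_of_subset (Finset.erase_subset _ _)
        _ ≤ _ := lintegral_rpow_le_rpow_lintegral (hSm.pow_const p)
            (sub_nonneg.2 (inv_le_one_of_one_le₀ hp.le)) (by simp [hp0.le])
    calc ∫⁻ ω, ξ k ω * (∑ l, ξ l ω) ^ (p - 1) ∂P
        ≤ ∫⁻ ω, 3 * (ξ k ω * (∑ l ∈ Finset.univ.erase k, ξ l ω) ^ (p - 1)) +
            (2 * ENNReal.ofReal p) ^ (p - 1) * ξ k ω ^ p ∂P := by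
          refine lintegral_mono fun ω => ?_
          rw [← Finset.sum_erase_add _ _ (Finset.mem_univ k), ← mul_rpow_sub_one (ξ k ω) hp.le]
          refine (mul_le_mul_right (add_rpow_sub_one_le _ _ hp.le) _).trans_eq ?_
          ring
      _ = 3 * ((∫⁻ ω, ξ k ω ∂P) *
            ∫⁻ ω, (∑ l ∈ Finset.univ.erase k, ξ l ω) ^ (p - 1) ∂P) +
            (2 * ENNReal.ofReal p) ^ (p - 1) * ∫⁻ ω, ξ k ω ^ p ∂P := by
          rw [lintegral_add_left (by fun_prop), lintegral_const_mul _ (by fun_prop),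
            lintegral_const_mul _ (by fun_prop), hind]
      _ ≤ _ := by gcongr
  have hmain : u ≤ 3 * (∑ k, ∫⁻ ω, ξ k ω ∂P) * u ^ (1 - p⁻¹) +
      (2 * ENNReal.ofReal p) ^ (p - 1) * ∑ k, ∫⁻ ω, ξ k ω ^ p ∂P := by
    -- One factor of `S ^ p = S * S ^ (p - 1)` is expanded as a sum over `k`.
    calc u = ∑ k, ∫⁻ ω, ξ k ω * (∑ l, ξ l ω) ^ (p - 1) ∂P := by
          rw [← lintegral_finsetSum _ (fun k _ => by fun_prop), hu]
          refine lintegral_congr fun ω => ?_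
          rw [← Finset.sum_mul, mul_rpow_sub_one _ hp.le]
      _ ≤ _ := Finset.sum_le_sum fun k _ => hterm k
      _ = _ := by
          rw [Finset.sum_add_distrib, ← Finset.mul_sum, ← Finset.mul_sum, ← Finset.sum_mul]; ring
  refine (le_of_le_mul_rpow_add hp.le hutop hmain).trans ?_
  rw [mul_add]
  gcongr ?_ + ?_
  · rw [← mul_assoc, ENNReal.mul_rpow_of_nonneg _ _ hp0.le]
    norm_num
  · rw [← mul_assoc, ← mul_assoc]
    refine mul_le_mul_left ?_ _
    calc 2 * (2 * ENNReal.ofReal p) ^ (p - 1)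
        ≤ (2 * ENNReal.ofReal p) * (2 * ENNReal.ofReal p) ^ (p - 1) := by
          gcongr
          exact le_mul_of_one_le_right zero_le hP1
      _ = (2 * ENNReal.ofReal p) ^ p := mul_rpow_sub_one _ hp.le
      _ ≤ (6 * ENNReal.ofReal p) ^ p := by gcongr; norm_num
      _ = _ := ENNReal.mul_rpow_of_nonneg _ _ hp0.le

/-- The sum of the `p`-th moments is controlled by the moment of the maximum and the mean of the
sum, when `t` is such that all variables are at most `t` with probability at least `1/2`. -/
theorem sum_lintegral_rpow_le {ξ : ι → Ω → ℝ≥0∞} (hm : ∀ k, Measurable (ξ k))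
    (hi : iIndepFun ξ P) {p : ℝ} (hp : 1 < p) {t : ℝ≥0∞}
    (ht : 1 ≤ 2 * P {ω | ∀ k, ξ k ω ≤ t}) :
    ∑ k, ∫⁻ ω, ξ k ω ^ p ∂P ≤
      2 * (∫⁻ ω, ⨆ k, ξ k ω ^ p ∂P) + t ^ (p - 1) * ∑ k, ∫⁻ ω, ξ k ω ∂P := by
  classical
  have hp0 : 0 < p := by linarith
  let φ : ℝ≥0∞ → ℝ≥0∞ := (Set.Ioi t).indicator fun x => x ^ p
  let ψ : ℝ≥0∞ → ℝ≥0∞ := (Set.Iic t).indicator 1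
  have hφ : Measurable φ := Measurable.indicator (by fun_prop) measurableSet_Ioi
  have hψ : Measurable ψ := measurable_one.indicator measurableSet_Iic
  -- `G k` indicates that all variables other than the `k`-th are at most `t`. It is independent of
  -- `ξ k` and has mean at least `1/2`, so inserting it costs a factor 2.
  let G : ι → Ω → ℝ≥0∞ := fun k ω => ∏ l ∈ Finset.univ.erase k, ψ (ξ l ω)
  have hGm : ∀ k, Measurable (G k) := fun k =>
    Finset.measurable_prod _ fun l _ => hψ.comp (hm l)
  have hind : ∀ k, ∫⁻ ω, φ (ξ k ω) * G k ω ∂P =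
      (∫⁻ ω, φ (ξ k ω) ∂P) * ∫⁻ ω, G k ω ∂P := by
    intro k
    let g : ι → ℝ≥0∞ → ℝ≥0∞ := fun l => if l = k then φ else ψ
    have hg : ∀ l, Measurable (g l) := fun l => by
      by_cases h : l = k <;> simp [g, h, hφ, hψ]
    have h := ((hi.comp g hg).indepFun_finsetProd_of_notMem (fun l => (hg l).comp (hm l))
      (Finset.notMem_erase k Finset.univ)).symm
    have hG : (∏ l ∈ Finset.univ.erase k, g l ∘ ξ l) = G k := by
      ext ω
      simp only [Finset.prod_apply, G]
      refine Finset.prod_congr rfl fun l hl => ?_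
      simp [g, Finset.ne_of_mem_erase hl]
    rw [hG] at h
    have hk : g k ∘ ξ k = fun ω => φ (ξ k ω) := by ext ω; simp [g]
    rw [hk] at h
    simpa using lintegral_mul_eq_lintegral_mul_lintegral_of_indepFun (hφ.comp (hm k)) (hGm k) h
  have hGint : ∀ k, 1 ≤ 2 * ∫⁻ ω, G k ω ∂P := by
    intro k
    refine ht.trans ?_
    gcongr
    have hms : MeasurableSet {ω | ∀ k, ξ k ω ≤ t} := by
      rw [Set.ofPred_forall]
      exact MeasurableSet.iInter fun l => measurableSet_le (hm l) measurable_const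
    rw [← lintegral_indicator_one hms]
    refine lintegral_mono fun ω => ?_
    by_cases h : ∀ k, ξ k ω ≤ t
    · simp [G, ψ, h]
    · simp [h]
  -- At most one summand is nonzero: if the `k`-th is, every other variable is at most `t`, where
  -- `φ` vanishes.
  have hpt : ∀ ω, ∑ k, φ (ξ k ω) * G k ω ≤ ⨆ k, ξ k ω ^ p := by
    intro ω
    by_cases h : ∃ k, φ (ξ k ω) * G k ω ≠ 0
    · obtain ⟨k, hk⟩ := h
      rw [Finset.sum_eq_single k]
      · refine le_trans ?_ (le_iSup (fun k => ξ k ω ^ p) k)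
        have h1 : G k ω ≤ 1 := Finset.prod_le_one' fun l _ =>
          Set.indicator_le_self' (by simp) _
        have h2 : φ (ξ k ω) ≤ ξ k ω ^ p := Set.indicator_le_self _ _ _
        simpa using mul_le_mul' h2 h1
      · intro l _ hl
        have h1 : ψ (ξ l ω) ≠ 0 := by
          intro h0
          apply hk
          simp only [G]
          rw [Finset.prod_eq_zero (Finset.mem_erase.2 ⟨hl, Finset.mem_univ l⟩) h0, mul_zero]
        have h2 : ξ l ω ≤ t := Set.mem_of_indicator_ne_zero h1
        have h3 : φ (ξ l ω) = 0 := Set.indicator_of_notMem (by simpa using h2) _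
        rw [h3, zero_mul]
      · simp
    · push Not at h
      simp [h]
  have hsplit : ∀ k, ∫⁻ ω, ξ k ω ^ p ∂P ≤
      2 * (∫⁻ ω, φ (ξ k ω) * G k ω ∂P) + t ^ (p - 1) * ∫⁻ ω, ξ k ω ∂P := by
    intro k
    calc ∫⁻ ω, ξ k ω ^ p ∂P ≤ ∫⁻ ω, φ (ξ k ω) + t ^ (p - 1) * ξ k ω ∂P := by
          refine lintegral_mono fun ω => ?_
          by_cases h : ξ k ω ≤ t
          · refine le_trans ?_ le_add_self
            rw [← mul_rpow_sub_one _ hp.le, mul_comm]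
            gcongr
          · refine le_trans ?_ le_self_add
            simp [φ, not_le.1 h]
      _ = (∫⁻ ω, φ (ξ k ω) ∂P) + t ^ (p - 1) * ∫⁻ ω, ξ k ω ∂P := by
          rw [lintegral_add_left (f := fun ω => φ (ξ k ω)) (hφ.comp (hm k)),
            lintegral_const_mul _ (hm k)]
      _ ≤ _ := by
          gcongr
          rw [hind k]
          calc _ = (∫⁻ ω, φ (ξ k ω) ∂P) * 1 := (mul_one _).symm
            _ ≤ (∫⁻ ω, φ (ξ k ω) ∂P) * (2 * ∫⁻ ω, G k ω ∂P) := by gcongr; exact hGint k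
            _ = _ := by ring
  calc _ ≤ _ := Finset.sum_le_sum fun k _ => hsplit k
    _ = 2 * (∫⁻ ω, ∑ k, φ (ξ k ω) * G k ω ∂P) + t ^ (p - 1) * ∑ k, ∫⁻ ω, ξ k ω ∂P := by
        rw [Finset.sum_add_distrib, ← Finset.mul_sum, ← Finset.mul_sum,
          lintegral_finsetSum (f := fun k ω => φ (ξ k ω) * G k ω) _
            (fun k _ => (hφ.comp (hm k)).mul (hGm k))]
    _ ≤ _ := by gcongr with ω; exact hpt ω

/-- Markov's inequality at twice the mean; mean zero is separate because the mean is cancelled. -/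
theorem one_le_two_mul_measure_le [IsProbabilityMeasure P] {M : Ω → ℝ≥0∞} (hM : Measurable M)
    (htop : ∫⁻ ω, M ω ∂P ≠ ∞) : 1 ≤ 2 * P {ω | M ω ≤ 2 * ∫⁻ ω, M ω ∂P} := by
  set e := ∫⁻ ω, M ω ∂P with he
  have hms : MeasurableSet {ω | M ω ≤ 2 * e} := measurableSet_le hM measurable_const
  have hc : 2 * P {ω | M ω ≤ 2 * e}ᶜ ≤ 1 := by
    rcases eq_or_ne e 0 with h0 | h0
    · have : P {ω | M ω ≤ 2 * e}ᶜ = 0 := by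
        have := (lintegral_eq_zero_iff hM).1 (he ▸ h0)
        rw [← mem_ae_iff]
        filter_upwards [this] with ω hω
        simp [hω]
      simp [this]
    · have h := mul_meas_ge_le_lintegral (μ := P) hM (2 * e)
      have h2 : 2 * P {ω | M ω ≤ 2 * e}ᶜ * e ≤ 1 * e := by
        rw [one_mul]
        refine le_trans ?_ h
        rw [mul_right_comm]
        gcongr
        intro ω hω
        exact (not_le.1 (show ¬ M ω ≤ 2 * e from hω)).le
      exact (ENNReal.mul_le_mul_iff_left h0 htop).1 h2
  have h1 : (1 : ℝ≥0∞) + 1 = 2 * P {ω | M ω ≤ 2 * e} + 2 * P {ω | M ω ≤ 2 * e}ᶜ := by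
    rw [← mul_add, measure_add_measure_compl hms, measure_univ]; norm_num
  have h3 : (1 : ℝ≥0∞) + 1 ≤ 2 * P {ω | M ω ≤ 2 * e} + 1 := h1 ▸ by gcongr
  exact (ENNReal.add_le_add_iff_right ENNReal.one_ne_top).1 h3

/-- Since `p ≤ e^(p-1) ≤ 3^(p-1)`, a power of `p` can be written as a `(p-1)`-st power and absorbed
into a threshold. -/
theorem rpow_natCast_mul_le (d : ℕ) {p : ℝ} (hp : 1 ≤ p) :
    ENNReal.ofReal p ^ ((d : ℝ) * p) ≤ (3 ^ ((d : ℝ) * p)) ^ (p - 1) := by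
  have hp0 : 0 < p := by linarith
  rw [← ENNReal.rpow_mul, mul_comm ((d : ℝ) * p) (p - 1), ENNReal.rpow_mul 3]
  refine ENNReal.rpow_le_rpow ?_ (by positivity)
  rw [show (3 : ℝ≥0∞) = ENNReal.ofReal 3 by simp, ENNReal.ofReal_rpow_of_pos (by norm_num)]
  refine ENNReal.ofReal_le_ofReal ?_
  calc p ≤ Real.exp (p - 1) := by linarith [Real.add_one_le_exp (p - 1)]
    _ = Real.exp 1 ^ (p - 1) := by rw [← Real.exp_mul, one_mul]
    _ ≤ 3 ^ (p - 1) := Real.rpow_le_rpow (by positivity)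
        (Real.exp_one_lt_d9.le.trans (by norm_num)) (by linarith)

/-- Comparison of the sum of the `p`-th moments with the `p`-th moment of the maximum. -/
theorem rpow_mul_sum_lintegral_rpow_le [IsProbabilityMeasure P] {ξ : ι → Ω → ℝ≥0∞} (hm : ∀ k, Measurable (ξ k))
    (hi : iIndepFun ξ P) {p : ℝ} (hp : 1 < p) (d : ℕ) :
    ENNReal.ofReal p ^ ((d : ℝ) * p) * ∑ k, ∫⁻ ω, ξ k ω ^ p ∂P ≤
      (4 * 3 ^ (d : ℝ)) ^ p *
        (ENNReal.ofReal p ^ ((d : ℝ) * p) * (∫⁻ ω, ⨆ k, ξ k ω ^ p ∂P) +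
          (∑ k, ∫⁻ ω, ξ k ω ∂P) ^ p) := by
  have hp0 : 0 < p := by linarith
  have hr : 0 < p - 1 := by linarith
  set Q := ENNReal.ofReal p ^ ((d : ℝ) * p) with hQ
  have hQ0 : Q ≠ 0 := by simp [hQ, ENNReal.rpow_eq_zero_iff, hp0]
  set e := ∫⁻ ω, ⨆ k, ξ k ω ^ p ∂P
  set μ := ∑ k, ∫⁻ ω, ξ k ω ∂P
  have h40 : ((4 : ℝ≥0∞) * 3 ^ (d : ℝ)) ^ p ≠ 0 := by
    simp [ENNReal.rpow_eq_zero_iff, hp0.not_gt]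
  rcases eq_or_ne e ∞ with htop | htop
  · rw [htop, ENNReal.mul_top hQ0, top_add, ENNReal.mul_top h40]
    exact le_top
  -- With `t ^ p` twice the mean of the maximum, all variables are at most `t` with probability at
  -- least `1/2`.
  set t := (2 * e) ^ p⁻¹ with ht
  have hts : 1 ≤ 2 * P {ω | ∀ k, ξ k ω ≤ t} := by
    have hM : Measurable fun ω => ⨆ k, ξ k ω ^ p := Measurable.iSup fun k => by fun_prop
    refine (one_le_two_mul_measure_le hM htop).trans ?_
    gcongr with ω
    intro hω k
    rw [ht, ENNReal.le_rpow_inv_iff hp0]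
    exact (le_iSup (fun k => ξ k ω ^ p) k).trans hω
  have h := sum_lintegral_rpow_le hm hi hp hts
  have htp : t ^ p = 2 * e := ENNReal.rpow_inv_rpow hp0.ne' _
  set c : ℝ≥0∞ := 3 ^ ((d : ℝ) * p) with hc
  have hc1 : 1 ≤ c := by
    simpa using ENNReal.rpow_le_rpow (show (1 : ℝ≥0∞) ≤ 3 by norm_num)
      (show 0 ≤ (d : ℝ) * p by positivity)
  have hcr : Q ≤ c ^ (p - 1) := rpow_natCast_mul_le d hp.le
  -- The weight `Q` stays off the mean: if `μ ≤ c t`, the product is charged to `t ^ p = 2 e`;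
  -- otherwise `Q ≤ c ^ (p - 1)` turns `t ^ (p - 1)` into `(c t) ^ (p - 1) ≤ μ ^ (p - 1)`.
  have hkey : Q * (t ^ (p - 1) * μ) ≤ c * (Q * (2 * e)) + μ ^ p := by
    rcases le_total μ (c * t) with h' | h'
    · refine le_trans ?_ le_self_add
      calc Q * (t ^ (p - 1) * μ) ≤ Q * (t ^ (p - 1) * (c * t)) := by gcongr
        _ = c * (Q * (t * t ^ (p - 1))) := by ring
        _ = _ := by rw [mul_rpow_sub_one _ hp.le, htp]
    · refine le_trans ?_ le_add_self
      calc Q * (t ^ (p - 1) * μ) ≤ c ^ (p - 1) * (t ^ (p - 1) * μ) := by gcongr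
        _ = μ * (c * t) ^ (p - 1) := by rw [ENNReal.mul_rpow_of_nonneg _ _ hr.le]; ring
        _ ≤ μ * μ ^ (p - 1) := by gcongr
        _ = _ := mul_rpow_sub_one _ hp.le
  have h4 : 4 * c ≤ (4 * 3 ^ (d : ℝ)) ^ p := by
    rw [ENNReal.mul_rpow_of_nonneg _ _ hp0.le, ← ENNReal.rpow_mul]
    gcongr
    calc (4 : ℝ≥0∞) = 4 ^ (1 : ℝ) := by simp
      _ ≤ _ := ENNReal.rpow_le_rpow_of_exponent_le (by norm_num) hp.le
  calc Q * ∑ k, ∫⁻ ω, ξ k ω ^ p ∂P ≤ Q * (2 * e + t ^ (p - 1) * μ) := by gcongr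
    _ = 1 * (Q * (2 * e)) + Q * (t ^ (p - 1) * μ) := by ring
    _ ≤ c * (Q * (2 * e)) + (c * (Q * (2 * e)) + 4 * c * μ ^ p) := by
        gcongr
        refine hkey.trans ?_
        gcongr
        refine le_mul_of_one_le_left zero_le ?_
        calc (1 : ℝ≥0∞) ≤ 1 * 1 := by simp
          _ ≤ _ := by gcongr; norm_num
    _ = 4 * c * (Q * e + μ ^ p) := by ring
    _ ≤ _ := by gcongr

end OneSample

/-! ### Conditional versions, with part of the array integrated out -/

section Marginal

variable {δ S : Type*} [DecidableEq δ] [MeasurableSpace S] {μ : δ → Measure S}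

theorem dependsOn_lmarginal {f : (δ → S) → ℝ≥0∞} {t : Set δ} (hf : DependsOn f t)
    (s : Finset δ) : DependsOn (lmarginal μ s f) (t \ s) := fun x y h => by
  refine lintegral_congr fun z => hf.updateFinset z h

theorem lmarginal_finsetSum {κ : Type*} (s : Finset δ) (t : Finset κ)
    {f : κ → (δ → S) → ℝ≥0∞} (hf : ∀ k, Measurable (f k)) (x : δ → S) :
    lmarginal μ s (fun y => ∑ k ∈ t, f k y) x = ∑ k ∈ t, lmarginal μ s (f k) x :=
  lintegral_finsetSum _ fun k _ => (hf k).comp measurable_updateFinset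

theorem lmarginal_add (s : Finset δ) {f g : (δ → S) → ℝ≥0∞} (hf : Measurable f) (x : δ → S) :
    lmarginal μ s (fun y => f y + g y) x = lmarginal μ s f x + lmarginal μ s g x :=
  lintegral_add_left (hf.comp measurable_updateFinset) _

theorem lmarginal_const_mul (s : Finset δ) (r : ℝ≥0∞) {f : (δ → S) → ℝ≥0∞}
    (hf : Measurable f) (x : δ → S) :
    lmarginal μ s (fun y => r * f y) x = r * lmarginal μ s f x :=
  lintegral_const_mul _ (hf.comp measurable_updateFinset)

variable [∀ a, IsProbabilityMeasure (μ a)]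

theorem lmarginal_of_dependsOn {f : (δ → S) → ℝ≥0∞} {t : Set δ} (hf : DependsOn f t)
    {s : Finset δ} (hst : ∀ a ∈ s, a ∉ t) : lmarginal μ s f = f := by
  ext x
  have : ∀ z : (a : s) → S, f (Function.updateFinset x s z) = f x := fun z =>
    hf fun a ha => by
      have : a ∉ s := fun h => hst a h ha
      simp [Function.updateFinset, this]
  simp [lmarginal, this]

theorem rpow_lmarginal_le (s : Finset δ) {f : (δ → S) → ℝ≥0∞} (hf : Measurable f) {p : ℝ}
    (hp : 1 ≤ p) (x : δ → S) :
    lmarginal μ s f x ^ p ≤ lmarginal μ s (fun y => f y ^ p) x :=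
  rpow_lintegral_le_lintegral_rpow (hf.comp measurable_updateFinset) hp

variable {ι : Type*}

/-- With the coordinates outside `s` frozen at `x`, each `f k` is a function of the single
coordinate `e k`, and these are distinct coordinates of a product measure. -/
theorem iIndepFun_updateFinset {s : Finset δ} {e : ι → δ} (he : Function.Injective e)
    (hes : ∀ k, e k ∈ s) {f : ι → (δ → S) → ℝ≥0∞} (hf : ∀ k, Measurable (f k))
    (hd : ∀ k, DependsOn (f k) {a | a ∈ s → a = e k}) (x : δ → S) :
    iIndepFun (fun k z => f k (Function.updateFinset x s z))
      (Measure.pi fun a : s => μ a) := by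
  have h1 : iIndepFun (fun (a : s) (z : s → S) => z a) (Measure.pi fun a : s => μ a) :=
    iIndepFun_pi (X := fun _ => id) fun _ => aemeasurable_id
  have h2 := h1.precomp (g := fun k : ι => (⟨e k, hes k⟩ : s))
    fun k l h => he (congrArg Subtype.val h)
  have h3 := h2.comp (fun k z => f k (Function.update x (e k) z))
    fun k => (hf k).comp (measurable_update x)
  convert! h3 using 2 with k
  ext z
  refine hd k fun a ha => ?_
  by_cases has : a ∈ s
  · obtain rfl := ha has
    simp [Function.updateFinset, has]
  · have : a ≠ e k := fun h => has (h ▸ hes k)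
    simp [Function.updateFinset, has, this]

variable [Fintype ι]

theorem lmarginal_sum_rpow_le {s : Finset δ} {e : ι → δ} (he : Function.Injective e)
    (hes : ∀ k, e k ∈ s) {f : ι → (δ → S) → ℝ≥0∞} (hf : ∀ k, Measurable (f k))
    (hd : ∀ k, DependsOn (f k) {a | a ∈ s → a = e k}) {p : ℝ} (hp : 1 < p) (x : δ → S) :
    lmarginal μ s (fun y => (∑ k, f k y) ^ p) x ≤ 6 ^ p *
      ((∑ k, lmarginal μ s (f k) x) ^ p +
        ENNReal.ofReal p ^ p * ∑ k, lmarginal μ s (fun y => f k y ^ p) x) :=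
  lintegral_sum_rpow_le (fun k => (hf k).comp measurable_updateFinset)
    (iIndepFun_updateFinset he hes hf hd x) hp

theorem rpow_mul_sum_lmarginal_rpow_le {s : Finset δ} {e : ι → δ} (he : Function.Injective e)
    (hes : ∀ k, e k ∈ s) {f : ι → (δ → S) → ℝ≥0∞} (hf : ∀ k, Measurable (f k))
    (hd : ∀ k, DependsOn (f k) {a | a ∈ s → a = e k}) {p : ℝ} (hp : 1 < p) (d : ℕ)
    (x : δ → S) :
    ENNReal.ofReal p ^ ((d : ℝ) * p) * ∑ k, lmarginal μ s (fun y => f k y ^ p) x ≤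
      (4 * 3 ^ (d : ℝ)) ^ p *
        (ENNReal.ofReal p ^ ((d : ℝ) * p) * lmarginal μ s (fun y => ⨆ k, f k y ^ p) x +
          (∑ k, lmarginal μ s (f k) x) ^ p) :=
  rpow_mul_sum_lintegral_rpow_le (fun k => (hf k).comp measurable_updateFinset)
    (iIndepFun_updateFinset he hes hf hd x) hp d

end Marginal

/-! ### Sums over multi-indices with some places fixed -/

section Agree

variable {m n : ℕ}

/-- The multi-indices that agree with `c` outside `I`. -/
def agree (I : Finset (Fin m)) (c : Fin m → Fin n) : Finset (Fin m → Fin n) :=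
  Finset.univ.filter fun i => ∀ j ∉ I, i j = c j

variable {I J : Finset (Fin m)} {c i : Fin m → Fin n} {j : Fin m}

@[simp]
theorem mem_agree : i ∈ agree I c ↔ ∀ j ∉ I, i j = c j := by simp [agree]

theorem sum_agree_insert {M : Type*} [AddCommMonoid M] (hj : j ∉ I) (f : (Fin m → Fin n) → M) :
    ∑ i ∈ agree (insert j I) c, f i = ∑ k, ∑ i ∈ agree I (Function.update c j k), f i := by
  rw [← Finset.sum_fiberwise (agree (insert j I) c) (fun i => i j) f]
  refine Finset.sum_congr rfl fun k _ => Finset.sum_congr ?_ fun _ _ => rfl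
  ext i
  simp only [Finset.mem_filter, mem_agree, Finset.mem_insert, not_or]
  constructor
  · rintro ⟨h, rfl⟩ l hl
    by_cases hlj : l = j
    · subst hlj; simp
    · simp [hlj, h l ⟨hlj, hl⟩]
  · intro h
    exact ⟨fun l hl => by simpa [hl.1] using h l hl.2, by simpa using h j hj⟩

theorem sum_agree_update {M : Type*} [AddCommMonoid M] (hj : j ∉ I) (f : (Fin m → Fin n) → M)
    (k : Fin n) :
    ∑ i ∈ agree I (Function.update c j k), f i =
      ∑ i ∈ agree I c, f (Function.update i j k) := by
  refine Finset.sum_nbij' (fun i => Function.update i j (c j))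
    (fun i => Function.update i j k) ?_ ?_ ?_ ?_ ?_
  · intro i hi
    rw [mem_agree] at hi ⊢
    intro l hl
    by_cases hlj : l = j
    · subst hlj; simp
    · simpa [hlj] using hi l hl
  · intro i hi
    rw [mem_agree] at hi ⊢
    intro l hl
    by_cases hlj : l = j
    · subst hlj; simp
    · simpa [hlj] using hi l hl
  · intro i hi
    rw [mem_agree] at hi
    have := hi j hj
    simp only [Function.update_self] at this
    rw [Function.update_idem, ← this, Function.update_eq_self]
  · intro i hi
    rw [mem_agree] at hi
    rw [Function.update_idem, ← hi j hj, Function.update_eq_self]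
  · intro i hi
    rw [mem_agree] at hi
    have := hi j hj
    simp only [Function.update_self] at this
    rw [Function.update_idem, ← this, Function.update_eq_self]

theorem agree_update_subset (k : Fin n) :
    agree I (Function.update c j k) ⊆ agree (insert j I) c := by
  intro i hi
  rw [mem_agree] at hi ⊢
  intro l hl
  rw [Finset.mem_insert, not_or] at hl
  simpa [hl.1] using hi l hl.2

theorem sum_agree_sdiff {M : Type*} [AddCommMonoid M] (hJ : J ⊆ I)
    (f : (Fin m → Fin n) → M) :
    ∑ b ∈ agree J c, ∑ i ∈ agree (I \ J) b, f i = ∑ i ∈ agree I c, f i := by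
  classical
  -- The fibre of `i` is labelled by the index equal to `i` on `J` and to `c` elsewhere.
  rw [← Finset.sum_fiberwise_of_maps_to (s := agree I c) (t := agree J c)
    (g := fun i l => if l ∈ J then i l else c l)]
  · refine Finset.sum_congr rfl fun b hb => Finset.sum_congr ?_ fun _ _ => rfl
    rw [mem_agree] at hb
    ext i
    simp only [Finset.mem_filter, mem_agree, Finset.mem_sdiff, not_and, not_not, funext_iff]
    constructor
    · intro h
      refine ⟨fun l hl => ?_, fun l => ?_⟩
      · rw [h l fun h' => absurd h' hl, hb l fun h' => hl (hJ h')]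
      · by_cases hl : l ∈ J
        · simp [hl, h l fun _ => hl]
        · simp [hl, hb l hl]
    · rintro ⟨h1, h2⟩ l hl
      by_cases hlJ : l ∈ J
      · simpa [hlJ] using h2 l
      · rw [hb l hlJ, h1 l fun h => hlJ (hl h)]
  · intro i _
    rw [mem_agree]
    intro l hl
    simp [hl]

end Agree

/-! ### Induction on the number of groups -/

section Recursion

variable {m n : ℕ} {S : Type v} [MeasurableSpace S] {μ : Fin m × Fin n → Measure S}

/-- All the positions of the array whose group belongs to `I`. -/
def block (n : ℕ) (I : Finset (Fin m)) : Finset (Fin m × Fin n) := I ×ˢ Finset.univ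

@[simp]
theorem mem_block {I : Finset (Fin m)} {a : Fin m × Fin n} : a ∈ block n I ↔ a.1 ∈ I := by
  simp [block]

/-- `max_{i_J} ∑_{i_{I \ J}} E_{I \ J} H_i`, the indices outside `I` being those of `c`. -/
noncomputable def condMax (μ : Fin m × Fin n → Measure S)
    (H : (Fin m → Fin n) → (Fin m × Fin n → S) → ℝ≥0∞) (c : Fin m → Fin n)
    (I J : Finset (Fin m)) (x : Fin m × Fin n → S) : ℝ≥0∞ :=
  ⨆ b ∈ agree J c, ∑ i ∈ agree (I \ J) b, lmarginal μ (block n (I \ J)) (H i) x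

variable {H : (Fin m → Fin n) → (Fin m × Fin n → S) → ℝ≥0∞} {c : Fin m → Fin n}
  {I J : Finset (Fin m)} {j : Fin m}

theorem measurable_condMax [∀ a, IsProbabilityMeasure (μ a)] (hH : ∀ i, Measurable (H i)) :
    Measurable (condMax μ H c I J) := by
  refine Measurable.iSup fun b => Measurable.iSup fun _ => ?_
  exact Finset.measurable_sum _ fun i _ => (hH i).lmarginal μ

variable [∀ a, IsProbabilityMeasure (μ a)]

theorem lmarginal_block_union {f : (Fin m × Fin n → S) → ℝ≥0∞} (hf : Measurable f)
    (hIJ : Disjoint I J) :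
    lmarginal μ (block n (I ∪ J)) f =
      lmarginal μ (block n I) (lmarginal μ (block n J) f) := by
  rw [← lmarginal_union μ f hf, block, Finset.union_product]
  · rfl
  · rw [Finset.disjoint_left] at hIJ ⊢
    intro a
    simpa using @hIJ a.1

theorem lmarginal_block_comm {f : (Fin m × Fin n → S) → ℝ≥0∞} (hf : Measurable f)
    (hIJ : Disjoint I J) :
    lmarginal μ (block n I) (lmarginal μ (block n J) f) =
      lmarginal μ (block n J) (lmarginal μ (block n I) f) := by
  rw [← lmarginal_block_union hf hIJ, Finset.union_comm, lmarginal_block_union hf hIJ.symm]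

theorem lmarginal_block_insert {f : (Fin m × Fin n → S) → ℝ≥0∞} (hf : Measurable f)
    (hj : j ∉ I) :
    lmarginal μ (block n (insert j I)) f =
      lmarginal μ (block n I) (lmarginal μ (block n {j}) f) := by
  rw [← lmarginal_block_union hf (by simpa using hj), Finset.union_comm, ← Finset.insert_eq]

/-- Integrating out one group: the kernels `∑_k E_j H_{i, k}`. -/
noncomputable def integrateGroup (μ : Fin m × Fin n → Measure S)
    (H : (Fin m → Fin n) → (Fin m × Fin n → S) → ℝ≥0∞) (j : Fin m) (i : Fin m → Fin n)
    (x : Fin m × Fin n → S) : ℝ≥0∞ :=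
  ∑ k, lmarginal μ (block n {j}) (H (Function.update i j k)) x

theorem measurable_integrateGroup (hH : ∀ i, Measurable (H i)) (i : Fin m → Fin n) :
    Measurable (integrateGroup μ H j i) :=
  Finset.measurable_sum _ fun _ _ => (hH _).lmarginal μ

/-- `H i` depends on the variables of the groups in `I` only through those selected by `i`. -/
def DependsOnSelected (H : (Fin m → Fin n) → (Fin m × Fin n → S) → ℝ≥0∞)
    (I : Finset (Fin m)) : Prop :=
  ∀ i, DependsOn (H i) {a | a.1 ∈ I → a.2 = i a.1}

omit [∀ a, IsProbabilityMeasure (μ a)] in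
theorem DependsOnSelected.integrateGroup (hH : DependsOnSelected H (insert j I)) :
    DependsOnSelected (integrateGroup μ H j) I := by
  intro i x y h
  refine Finset.sum_congr rfl fun k _ => ?_
  refine dependsOn_lmarginal (hH _) _ fun a ha => h a fun haI => ?_
  simp only [Set.mem_sdiff, Set.mem_ofPred_eq, Finset.mem_coe, mem_block,
    Finset.mem_singleton] at ha
  simpa [ha.2] using ha.1 (Finset.mem_insert_of_mem haI)

omit [∀ a, IsProbabilityMeasure (μ a)] in
theorem sum_integrateGroup (hH : ∀ i, Measurable (H i)) (hj : j ∉ I) (x : Fin m × Fin n → S) :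
    ∑ i ∈ agree I c, integrateGroup μ H j i x =
      ∑ k, lmarginal μ (block n {j})
        (fun y => ∑ i ∈ agree I (Function.update c j k), H i y) x := by
  simp only [integrateGroup]
  rw [Finset.sum_comm]
  refine Finset.sum_congr rfl fun k _ => ?_
  rw [lmarginal_finsetSum _ _ hH, sum_agree_update hj]

theorem condMax_integrateGroup (hH : ∀ i, Measurable (H i)) (hj : j ∉ I) (hJ : J ⊆ I)
    (x : Fin m × Fin n → S) :
    condMax μ (integrateGroup μ H j) c I J x = condMax μ H c (insert j I) J x := by
  have hjJ : j ∉ J := fun h => hj (hJ h)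
  have hjd : j ∉ I \ J := fun h => hj (Finset.sdiff_subset h)
  simp only [condMax, Finset.insert_sdiff_of_notMem _ hjJ]
  refine iSup_congr fun b => iSup_congr fun _ => ?_
  rw [sum_agree_insert hjd, Finset.sum_congr rfl fun k _ => sum_agree_update hjd _ k,
    Finset.sum_comm]
  refine Finset.sum_congr rfl fun i _ => ?_
  rw [show integrateGroup μ H j i = fun y =>
      ∑ k, lmarginal μ (block n {j}) (H (Function.update i j k)) y from rfl,
    lmarginal_finsetSum _ _ fun k => (hH _).lmarginal μ]
  refine Finset.sum_congr rfl fun k _ => ?_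
  rw [lmarginal_block_insert (hH _) hjd]

omit [∀ a, IsProbabilityMeasure (μ a)] in
theorem dependsOn_condMax_update (hH : DependsOnSelected H (insert j I)) (hj : j ∉ I) (hJ : J ⊆ I)
    (k : Fin n) :
    DependsOn (condMax μ H (Function.update c j k) I J)
      {a | a ∈ block n {j} → a = (j, k)} := by
  intro x y h
  refine iSup_congr fun b => iSup_congr fun hb => Finset.sum_congr rfl fun i hi => ?_
  refine dependsOn_lmarginal (hH _) _ fun a ha => h a fun haj => ?_
  rw [mem_agree] at hb hi
  have hij : i j = k := by
    rw [hi j fun h => hj (Finset.sdiff_subset h), hb j fun h => hj (hJ h)]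
    simp
  obtain ⟨a1, a2⟩ := a
  simp only [mem_block, Finset.mem_singleton] at haj
  subst haj
  simpa [hij] using ha.1

omit [∀ a, IsProbabilityMeasure (μ a)] in
theorem condMax_le (hH : ∀ i, Measurable (H i)) (hJ : J ⊆ I) (x : Fin m × Fin n → S) :
    condMax μ H c I J x ≤
      lmarginal μ (block n (I \ J)) (fun y => ∑ i ∈ agree I c, H i y) x := by
  rw [lmarginal_finsetSum _ _ hH, ← sum_agree_sdiff hJ]
  refine iSup₂_le fun b hb => ?_
  exact Finset.single_le_sum
    (f := fun b => ∑ i ∈ agree (I \ J) b, lmarginal μ (block n (I \ J)) (H i) x)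
    (fun _ _ => zero_le) hb

/-- Bounding the maximum over `i_J` by the sum and interchanging expectations, the sum over `k` with
`E_j` rebuilds the integrated kernels. -/
theorem sum_lmarginal_condMax_le (hH : ∀ i, Measurable (H i)) (hj : j ∉ I) (hJ : J ⊆ I)
    (x : Fin m × Fin n → S) :
    ∑ k, lmarginal μ (block n {j}) (condMax μ H (Function.update c j k) I J) x ≤
      lmarginal μ (block n (I \ J))
        (fun y => ∑ i ∈ agree I c, integrateGroup μ H j i y) x := by
  have hm : ∀ k, Measurable fun y => ∑ i ∈ agree I (Function.update c j k), H i y :=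
    fun k => Finset.measurable_sum _ fun i _ => hH i
  simp only [sum_integrateGroup hH hj]
  rw [lmarginal_finsetSum _ _ fun k => (hm k).lmarginal μ]
  refine Finset.sum_le_sum fun k _ => ?_
  rw [lmarginal_block_comm (hm k)
    (Finset.disjoint_singleton_right.2 fun h => hj (Finset.sdiff_subset h))]
  exact lmarginal_mono (fun y => condMax_le hH hJ y) x

omit [∀ a, IsProbabilityMeasure (μ a)] in
-- The maxima over `k = i_j` and over `i_J` merge into one over `i_{J ∪ {j}}`.
theorem iSup_condMax_update_le (hj : j ∉ I) (x : Fin m × Fin n → S) :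
    ⨆ k, condMax μ H (Function.update c j k) I J x ≤
      condMax μ H c (insert j I) (insert j J) x := by
  have h : insert j I \ insert j J = I \ J := by
    ext l
    simp only [Finset.mem_sdiff, Finset.mem_insert, not_or]
    constructor
    · rintro ⟨rfl | h1, h2, h3⟩
      · exact absurd rfl h2
      · exact ⟨h1, h3⟩
    · rintro ⟨h1, h2⟩
      exact ⟨Or.inr h1, fun h => hj (h ▸ h1), h2⟩
  simp only [condMax, h]
  exact iSup_le fun k => biSup_mono fun b hb => agree_update_subset k hb

theorem iSup_rpow {κ : Sort*} (f : κ → ℝ≥0∞) {p : ℝ} (hp : 0 < p) :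
    (⨆ k, f k) ^ p = ⨆ k, f k ^ p :=
  (ENNReal.orderIsoRpow p hp).map_iSup f

variable (μ H) in
/-- The weighted sum of the moments of the conditional maxima. -/
noncomputable def momentSum (p : ℝ) (c : Fin m → Fin n) (I : Finset (Fin m))
    (x : Fin m × Fin n → S) : ℝ≥0∞ :=
  ∑ J ∈ I.powerset, ENNReal.ofReal p ^ ((J.card : ℝ) * p) *
    lmarginal μ (block n J) (fun y => condMax μ H c I J y ^ p) x

/-- The induction step. `V` comes from the mean in Rosenthal's inequality and reduces to the terms
without `j` (`W`). The sum of `p`-th moments yields the terms with `j` (`W'`) and one more `V` for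
each of the `2 ^ I.card` sets `J`. The hypothesis is used for the blocks and then for `V`, hence `K`
twice. -/
theorem lmarginal_sum_rpow_le_of_insert {p : ℝ} (hp : 1 < p) (hH : ∀ i, Measurable (H i))
    (hd : DependsOnSelected H (insert j I)) (hj : j ∉ I) {K : ℝ≥0∞} (hK : 1 ≤ K)
    (h1 : ∀ c x, lmarginal μ (block n I) (fun y => (∑ i ∈ agree I c, H i y) ^ p) x ≤
      K ^ p * momentSum μ H p c I x)
    (h2 : ∀ x, lmarginal μ (block n I)
        (fun y => (∑ i ∈ agree I c, integrateGroup μ H j i y) ^ p) x ≤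
      K ^ p * momentSum μ (integrateGroup μ H j) p c I x)
    (x : Fin m × Fin n → S) :
    lmarginal μ (block n (insert j I)) (fun y => (∑ i ∈ agree (insert j I) c, H i y) ^ p) x ≤
      (6 * ((2 ^ I.card + 1) * (K * (K * (4 * 3 ^ (I.card + 1)))))) ^ p *
        momentSum μ H p c (insert j I) x := by
  have hp0 : 0 < p := by linarith
  set q := ENNReal.ofReal p with hq
  set C : ℝ≥0∞ := 4 * 3 ^ (I.card + 1) with hC
  have hC1 : 1 ≤ C := by
    calc (1 : ℝ≥0∞) ≤ 1 * 1 ^ (I.card + 1) := by simp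
      _ ≤ _ := by rw [hC]; gcongr <;> norm_num
  set V := lmarginal μ (block n I)
    (fun y => (∑ i ∈ agree I c, integrateGroup μ H j i y) ^ p) x with hV
  have hdisj : Disjoint I {j} := Finset.disjoint_singleton_right.2 hj
  let B : Fin n → (Fin m × Fin n → S) → ℝ≥0∞ := fun k y =>
    ∑ i ∈ agree I (Function.update c j k), H i y
  have hB : ∀ k, Measurable (B k) := fun k => Finset.measurable_sum _ fun i _ => hH i
  have hBp : ∀ k, Measurable fun y => B k y ^ p := fun k => (hB k).pow_const p
  have hinj : Function.Injective fun k : Fin n => (j, k) := fun k l h => (Prod.ext_iff.1 h).2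
  have hmem : ∀ k : Fin n, (j, k) ∈ block n ({j} : Finset (Fin m)) := by simp
  have hBd : ∀ k, DependsOn (B k) {a | a ∈ block n {j} → a = (j, k)} := by
    intro k y z h
    refine Finset.sum_congr rfl fun i hi => hd i fun a ha => h a fun haj => ?_
    have hij : i j = k := by rw [mem_agree.1 hi j hj]; simp
    obtain ⟨a1, a2⟩ := a
    simp only [mem_block, Finset.mem_singleton] at haj
    subst haj
    simpa [hij] using ha
  have hIm : ∀ i, Measurable (integrateGroup μ H j i) := measurable_integrateGroup hH
  let ξ : Finset (Fin m) → Fin n → (Fin m × Fin n → S) → ℝ≥0∞ := fun J k =>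
    condMax μ H (Function.update c j k) I J
  have hξ : ∀ J k, Measurable (ξ J k) := fun J k => measurable_condMax hH
  have hξp : ∀ J k, Measurable fun y => ξ J k y ^ p := fun J k => (hξ J k).pow_const p
  -- separate the group `j`
  have hA : lmarginal μ (block n (insert j I))
      (fun y => (∑ i ∈ agree (insert j I) c, H i y) ^ p) x ≤
      6 ^ p * (V + q ^ p * ∑ k, lmarginal μ (block n {j})
        (lmarginal μ (block n I) fun y => B k y ^ p) x) := by
    rw [lmarginal_block_insert
      ((Finset.measurable_sum _ fun i _ => hH i).pow_const p) hj]
    simp only [sum_agree_insert hj]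
    have hpt := fun y => lmarginal_sum_rpow_le (μ := μ) hinj hmem hB hBd hp y
    refine (lmarginal_mono hpt x).trans_eq ?_
    simp only [B, ← sum_integrateGroup hH hj]
    rw [lmarginal_const_mul, lmarginal_add, lmarginal_const_mul, lmarginal_finsetSum]
    · congr 3
      refine Finset.sum_congr rfl fun k _ => ?_
      rw [lmarginal_block_comm (hBp k) hdisj]
    · exact fun k => (hBp k).lmarginal μ
    · exact Finset.measurable_sum _ fun k _ => (hBp k).lmarginal μ
    · exact (Finset.measurable_sum _ fun i _ => hIm i).pow_const p
    · refine Measurable.add ?_ (measurable_const.mul ?_)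
      · exact (Finset.measurable_sum _ fun i _ => hIm i).pow_const p
      · exact Finset.measurable_sum _ fun k _ => (hBp k).lmarginal μ
  -- the terms where `j` is integrated out
  set W := ∑ J ∈ I.powerset, q ^ ((J.card : ℝ) * p) *
    lmarginal μ (block n J) (fun y => condMax μ H c (insert j I) J y ^ p) x with hW
  have hVW : V ≤ K ^ p * W := by
    refine (h2 x).trans_eq ?_
    congr 1
    refine Finset.sum_congr rfl fun J hJ => ?_
    simp only [condMax_integrateGroup hH hj (Finset.mem_powerset.1 hJ)]
    rfl
  set W' := ∑ J ∈ I.powerset, q ^ (((insert j J).card : ℝ) * p) *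
    lmarginal μ (block n (insert j J))
      (fun y => condMax μ H c (insert j I) (insert j J) y ^ p) x with hW'
  have hsum : momentSum μ H p c (insert j I) x = W + W' := Finset.sum_powerset_insert hj _
  have hJ : ∀ J ∈ I.powerset, q ^ p * (q ^ ((J.card : ℝ) * p) *
      ∑ k, lmarginal μ (block n {j}) (lmarginal μ (block n J) fun y => ξ J k y ^ p) x) ≤
      C ^ p * (q ^ (((insert j J).card : ℝ) * p) * lmarginal μ (block n (insert j J))
        (fun y => condMax μ H c (insert j I) (insert j J) y ^ p) x + V) := by
    intro J hJ
    rw [Finset.mem_powerset] at hJ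
    have hjJ : j ∉ J := fun h => hj (hJ h)
    have hCJ : (4 * 3 ^ ((J.card + 1 : ℕ) : ℝ) : ℝ≥0∞) ≤ C := by
      rw [hC, ENNReal.rpow_natCast]
      gcongr
      norm_num
    have hqq : q ^ p * q ^ ((J.card : ℝ) * p) = q ^ (((J.card + 1 : ℕ) : ℝ) * p) := by
      rw [← ENNReal.rpow_add_of_nonneg _ _ hp0.le (by positivity)]
      congr 1; push_cast; ring
    have hpt := fun y => rpow_mul_sum_lmarginal_rpow_le (μ := μ) hinj hmem (hξ J)
      (dependsOn_condMax_update hd hj hJ) hp (J.card + 1) y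
    have hms : Measurable fun y => ⨆ k, ξ J k y ^ p := Measurable.iSup fun k => hξp J k
    have hmS : Measurable fun y => (∑ k, lmarginal μ (block n {j}) (ξ J k) y) ^ p :=
      (Finset.measurable_sum _ fun k _ => (hξ J k).lmarginal μ).pow_const p
    calc _ = lmarginal μ (block n J) (fun y => q ^ (((J.card + 1 : ℕ) : ℝ) * p) *
          ∑ k, lmarginal μ (block n {j}) (fun y => ξ J k y ^ p) y) x := by
          rw [← mul_assoc, hqq, lmarginal_const_mul _ _
            (Finset.measurable_sum _ fun k _ => (hξp J k).lmarginal μ),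
            lmarginal_finsetSum _ _ fun k => (hξp J k).lmarginal μ]
          congr 1
          refine Finset.sum_congr rfl fun k _ => ?_
          rw [lmarginal_block_comm (hξp J k) (by simpa using hjJ)]
      _ ≤ _ := lmarginal_mono hpt x
      _ = (4 * 3 ^ ((J.card + 1 : ℕ) : ℝ)) ^ p * (q ^ (((J.card + 1 : ℕ) : ℝ) * p) *
            lmarginal μ (block n (insert j J)) (fun y => ⨆ k, ξ J k y ^ p) x +
            lmarginal μ (block n J)
              (fun y => (∑ k, lmarginal μ (block n {j}) (ξ J k) y) ^ p) x) := by
          rw [lmarginal_const_mul, lmarginal_add, lmarginal_const_mul,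
            lmarginal_block_insert hms hjJ]
          · exact hms.lmarginal μ
          · exact measurable_const.mul (hms.lmarginal μ)
          · exact (measurable_const.mul (hms.lmarginal μ)).add hmS
      _ ≤ _ := by
          rw [Finset.card_insert_of_notMem hjJ]
          gcongr
          · refine lmarginal_mono (fun y => ?_) x
            rw [← iSup_rpow _ hp0]
            exact ENNReal.rpow_le_rpow (iSup_condMax_update_le hj y) hp0.le
          -- Jensen's inequality moves the power inside `E_{I \ J}`, and `E_J E_{I \ J} = E_I`
          -- recovers `V`.
          · calc _ ≤ lmarginal μ (block n J) (lmarginal μ (block n (I \ J))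
                  fun y => (∑ i ∈ agree I c, integrateGroup μ H j i y) ^ p) x := by
                  refine lmarginal_mono (fun y => ?_) x
                  refine (ENNReal.rpow_le_rpow (sum_lmarginal_condMax_le hH hj hJ y)
                    hp0.le).trans ?_
                  exact rpow_lmarginal_le _ (Finset.measurable_sum _ fun i _ => hIm i) hp.le y
              _ = V := by
                  rw [← lmarginal_block_union
                    ((Finset.measurable_sum _ fun i _ => hIm i).pow_const p)
                    Finset.disjoint_sdiff, Finset.union_sdiff_of_subset hJ]
  have hB2 : q ^ p * ∑ k, lmarginal μ (block n {j})
      (lmarginal μ (block n I) fun y => B k y ^ p) x ≤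
      K ^ p * (C ^ p * (W' + 2 ^ I.card * V)) := by
    calc _ ≤ q ^ p * ∑ k, lmarginal μ (block n {j})
          (fun y => K ^ p * momentSum μ H p (Function.update c j k) I y) x := by
          gcongr with k
          exact lmarginal_mono (fun y => h1 (Function.update c j k) y) x
      _ = K ^ p * ∑ J ∈ I.powerset, q ^ p * (q ^ ((J.card : ℝ) * p) *
          ∑ k, lmarginal μ (block n {j})
            (lmarginal μ (block n J) fun y => ξ J k y ^ p) x) := by
          simp only [Finset.mul_sum]
          rw [Finset.sum_comm]
          refine Finset.sum_congr rfl fun k _ => ?_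
          have hm1 : ∀ J, Measurable fun y => q ^ ((J.card : ℝ) * p) *
              lmarginal μ (block n J) (fun y => ξ J k y ^ p) y := fun J =>
            measurable_const.mul ((hξp J k).lmarginal μ)
          simp only [momentSum]
          rw [lmarginal_const_mul _ _ (Finset.measurable_sum _ fun J _ => hm1 J),
            lmarginal_finsetSum _ _ hm1, Finset.mul_sum, Finset.mul_sum]
          refine Finset.sum_congr rfl fun J _ => ?_
          rw [lmarginal_const_mul _ _ ((hξp J k).lmarginal μ)]
          ring
      _ ≤ K ^ p * ∑ J ∈ I.powerset, C ^ p * (q ^ (((insert j J).card : ℝ) * p) *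
          lmarginal μ (block n (insert j J))
            (fun y => condMax μ H c (insert j I) (insert j J) y ^ p) x + V) := by
          exact mul_le_mul_right (Finset.sum_le_sum hJ) _
      _ = _ := by
          rw [← Finset.mul_sum, Finset.sum_add_distrib, Finset.sum_const, Finset.card_powerset]
          simp [hW']
  rw [hsum]
  have hKp : 1 ≤ K ^ p := by simpa using ENNReal.rpow_le_rpow hK hp0.le
  have hCp : 1 ≤ C ^ p := by simpa using ENNReal.rpow_le_rpow hC1 hp0.le
  calc _ ≤ 6 ^ p * (V + K ^ p * (C ^ p * (W' + 2 ^ I.card * V))) := hA.trans (by gcongr)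
    _ ≤ 6 ^ p * (K ^ p * W + K ^ p * (C ^ p * (W' + 2 ^ I.card * (K ^ p * W)))) := by gcongr
    -- The bound is inflated so that `W` and `W'` get the same coefficient.
    _ ≤ 6 ^ p * (K ^ p * (K ^ p * (C ^ p * W)) +
          K ^ p * (K ^ p * (C ^ p * ((2 ^ I.card + 1) * W' + 2 ^ I.card * W)))) := by
        refine mul_le_mul_right (add_le_add (mul_le_mul_right ?_ _) (mul_le_mul_right ?_ _)) _
        · exact (le_mul_of_one_le_left zero_le hCp).trans
            (le_mul_of_one_le_left zero_le hKp)
        · have h : C ^ p * (W' + 2 ^ I.card * (K ^ p * W)) ≤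
              C ^ p * (K ^ p * ((2 ^ I.card + 1) * W') + 2 ^ I.card * (K ^ p * W)) := by
            refine mul_le_mul_right (add_le_add_left ?_ _) _
            exact (le_mul_of_one_le_left zero_le le_add_self).trans
              (le_mul_of_one_le_left zero_le hKp)
          refine h.trans_eq ?_
          ring
    _ = 6 ^ p * ((2 ^ I.card + 1) * (K ^ p * (K ^ p * C ^ p))) * (W + W') := by ring
    _ ≤ 6 ^ p * ((2 ^ I.card + 1) ^ p * (K ^ p * (K ^ p * C ^ p))) * (W + W') := by
        gcongr
        nth_rewrite 1 [← ENNReal.rpow_one (2 ^ I.card + 1)]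
        exact ENNReal.rpow_le_rpow_of_exponent_le le_add_self hp.le
    _ = _ := by simp only [ENNReal.mul_rpow_of_nonneg _ _ hp0.le]

/-- The constants of the moment inequality for `d` groups of variables. -/
noncomputable def momentConst : ℕ → ℝ≥0∞
  | 0 => 1
  | d + 1 => 6 * ((2 ^ d + 1) * (momentConst d * (momentConst d * (4 * 3 ^ (d + 1)))))

theorem one_le_momentConst (d : ℕ) : 1 ≤ momentConst d := by
  induction d with
  | zero => exact le_rfl
  | succ d ih =>
    calc (1 : ℝ≥0∞) ≤ 1 * (1 * (1 * (1 * (1 * 1 ^ (d + 1))))) := by simp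
      _ ≤ _ := by
        rw [momentConst]
        gcongr
        · norm_num
        · exact le_add_self
        · norm_num
        · norm_num

theorem momentConst_ne_top (d : ℕ) : momentConst d ≠ ∞ := by
  induction d with
  | zero => simp [momentConst]
  | succ d ih => simp [momentConst, ENNReal.mul_eq_top, ih]

theorem lmarginal_sum_agree_rpow_le {p : ℝ} (hp : 1 < p) (I : Finset (Fin m))
    (H : (Fin m → Fin n) → (Fin m × Fin n → S) → ℝ≥0∞) (hH : ∀ i, Measurable (H i))
    (hd : DependsOnSelected H I) (c : Fin m → Fin n) (x : Fin m × Fin n → S) :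
    lmarginal μ (block n I) (fun y => (∑ i ∈ agree I c, H i y) ^ p) x ≤
      momentConst I.card ^ p * momentSum μ H p c I x := by
  induction I using Finset.induction generalizing H c x with
  | empty =>
    have h : agree ∅ c = {c} := by
      ext i
      simp [funext_iff]
    simp [momentConst, momentSum, condMax, block, h, -mem_agree]
  | insert j I hj ih =>
    rw [Finset.card_insert_of_notMem hj, momentConst]
    refine lmarginal_sum_rpow_le_of_insert hp hH hd hj (one_le_momentConst _) ?_ ?_ x
    · refine fun c x => ih H hH (fun i => (hd i).mono fun a ha h => ?_) c x
      exact ha (Finset.mem_insert_of_mem h)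
    · exact fun x => ih _ (measurable_integrateGroup hH) hd.integrateGroup c x

end Recursion

/-! ### Exchanging the mean for the quantile -/

section Quantile

variable {Ω : Type u} [MeasurableSpace Ω] {P : Measure Ω} {A : Ω → ℝ} {K p : ℝ}

theorem level_pos (hK : 0 < K) : 0 < level K p :=
  one_div_pos.2 (mul_pos (by positivity) (Real.rpow_pos_of_pos hK _))

theorem quantile_nonneg : 0 ≤ quantile P A K p := Real.sInf_nonneg fun _ h => h.1

theorem measure_lt_le_level (hA : Measurable A) (hp : 1 < p)
    (hU : ∫⁻ ω, ENNReal.ofReal (A ω ^ p) ∂P ≠ ∞) {t : ℝ} (ht : 0 < t)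
    (h : (∫⁻ ω, ENNReal.ofReal (A ω ^ p) ∂P).toReal ≤ level K p * t ^ p) :
    P {ω | t < A ω} ≤ ENNReal.ofReal (level K p) := by
  have htp : 0 < t ^ p := by positivity
  have hm : Measurable fun ω => ENNReal.ofReal (A ω ^ p) := by fun_prop
  have h1 := mul_meas_ge_le_lintegral (μ := P) hm (ENNReal.ofReal (t ^ p))
  have h2 : P {ω | t < A ω} ≤ P {ω | ENNReal.ofReal (t ^ p) ≤ ENNReal.ofReal (A ω ^ p)} := by
    refine measure_mono fun ω hω => ENNReal.ofReal_le_ofReal ?_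
    exact Real.rpow_le_rpow ht.le (le_of_lt hω) (by linarith)
  have h3 : ENNReal.ofReal (t ^ p) * P {ω | t < A ω} ≤
      ENNReal.ofReal (t ^ p) * ENNReal.ofReal (level K p) := by
    refine (mul_le_mul_right h2 _).trans (h1.trans ?_)
    rw [← ENNReal.ofReal_mul htp.le, mul_comm (t ^ p), ← ENNReal.ofReal_toReal hU]
    exact ENNReal.ofReal_le_ofReal h
  exact (ENNReal.mul_le_mul_iff_right (by simpa using htp) ENNReal.ofReal_ne_top).1 h3

theorem quantile_le (hA : Measurable A) (hp : 1 < p)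
    (hU : ∫⁻ ω, ENNReal.ofReal (A ω ^ p) ∂P ≠ ∞) {t : ℝ} (ht : 0 < t)
    (h : (∫⁻ ω, ENNReal.ofReal (A ω ^ p) ∂P).toReal ≤ level K p * t ^ p) :
    quantile P A K p ≤ t :=
  csInf_le ⟨0, fun _ h => h.1⟩ ⟨ht.le, measure_lt_le_level hA hp hU ht h⟩

theorem exists_toReal_le_level_mul (hK : 0 < K) (hp : 1 < p) (U : ℝ≥0∞) {t : ℝ}
    (ht : (U.toReal / level K p) ^ p⁻¹ < t) : 0 < t ∧ U.toReal ≤ level K p * t ^ p := by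
  have hp0 : 0 < p := by linarith
  have hl : 0 < level K p := level_pos hK
  have h0 : 0 ≤ U.toReal / level K p := by positivity
  have ht0 : 0 < t := lt_of_le_of_lt (by positivity) ht
  refine ⟨ht0, ?_⟩
  have := Real.rpow_le_rpow (by positivity) ht.le hp0.le
  rw [Real.rpow_inv_rpow h0 hp0.ne', div_le_iff₀ hl] at this
  linarith

theorem level_mul_quantile_rpow_le (hA : Measurable A) (hK : 0 < K) (hp : 1 < p)
    (hU : ∫⁻ ω, ENNReal.ofReal (A ω ^ p) ∂P ≠ ∞) :
    ENNReal.ofReal (level K p * quantile P A K p ^ p) ≤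
      ∫⁻ ω, ENNReal.ofReal (A ω ^ p) ∂P := by
  have hp0 : 0 < p := by linarith
  have hl : 0 < level K p := level_pos hK
  rw [← ENNReal.ofReal_toReal hU]
  refine ENNReal.ofReal_le_ofReal ?_
  set U := ∫⁻ ω, ENNReal.ofReal (A ω ^ p) ∂P
  have h0 : 0 ≤ U.toReal / level K p := by positivity
  have h : quantile P A K p ≤ (U.toReal / level K p) ^ p⁻¹ := by
    refine le_of_forall_gt_imp_ge_of_dense fun t ht => ?_
    obtain ⟨ht0, h⟩ := exists_toReal_le_level_mul hK hp U ht
    exact quantile_le hA hp hU ht0 h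
  have h2 := Real.rpow_le_rpow quantile_nonneg h hp0.le
  rw [Real.rpow_inv_rpow h0 hp0.ne', le_div_iff₀ hl] at h2
  linarith

/-- Amounts to `p + 1 ≤ 2 p` in the exponent of 2. -/
theorem one_div_rpow_le_level (hK : 0 < K) (hp : 1 < p) :
    1 / (4 * K) ^ (p / (p - 1)) ≤ level K p := by
  have hr : 0 < p - 1 := by linarith
  unfold level
  refine one_div_le_one_div_of_le (by positivity) ?_
  rw [Real.mul_rpow (by norm_num) hK.le]
  gcongr
  rw [show (4 : ℝ) = 2 ^ (2 : ℝ) by norm_num, ← Real.rpow_mul (by norm_num)]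
  refine Real.rpow_le_rpow_of_exponent_le (by norm_num) ?_
  rw [← mul_div_assoc]
  gcongr
  linarith

/-- The infimum is attained: the tail is continuous from below along `t₀ + 1/(N+1)`, and Markov's
inequality makes the set nonempty. -/
theorem measure_quantile_lt_le (hA : Measurable A) (hK : 0 < K) (hp : 1 < p)
    (hU : ∫⁻ ω, ENNReal.ofReal (A ω ^ p) ∂P ≠ ∞) :
    P {ω | quantile P A K p < A ω} ≤ ENNReal.ofReal (level K p) := by
  set t₀ := quantile P A K p with ht₀
  have hne : {t : ℝ | 0 ≤ t ∧ P {ω | t < A ω} ≤ ENNReal.ofReal (level K p)}.Nonempty := by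
    obtain ⟨t, ht⟩ := exists_gt
      (((∫⁻ ω, ENNReal.ofReal (A ω ^ p) ∂P).toReal / level K p) ^ p⁻¹)
    obtain ⟨ht0, h⟩ := exists_toReal_le_level_mul hK hp _ ht
    exact ⟨t, ht0.le, measure_lt_le_level hA hp hU ht0 h⟩
  have hset : {ω | t₀ < A ω} = ⋃ N : ℕ, {ω | t₀ + 1 / ((N : ℝ) + 1) < A ω} := by
    ext ω
    simp only [Set.mem_ofPred_eq, Set.mem_iUnion]
    constructor
    · intro h
      obtain ⟨N, hN⟩ := exists_nat_one_div_lt (sub_pos.2 h)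
      exact ⟨N, by linarith⟩
    · rintro ⟨N, hN⟩
      have : 0 < 1 / ((N : ℝ) + 1) := Nat.one_div_pos_of_nat
      linarith
  have hmono : Monotone fun N : ℕ => {ω | t₀ + 1 / ((N : ℝ) + 1) < A ω} := by
    intro N M hNM ω hω
    have : 1 / ((M : ℝ) + 1) ≤ 1 / ((N : ℝ) + 1) := Nat.one_div_le_one_div hNM
    simp only [Set.mem_ofPred_eq] at hω ⊢
    linarith
  rw [hset, hmono.measure_iUnion]
  refine iSup_le fun N => ?_
  obtain ⟨t, ht, htlt⟩ := exists_lt_of_csInf_lt hne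
    (show t₀ < t₀ + 1 / ((N : ℝ) + 1) from lt_add_of_pos_right _ Nat.one_div_pos_of_nat)
  exact (measure_mono fun ω hω => htlt.trans hω).trans ht.2

/-- Split `A ≤ t₀ + A 1_{A > t₀}` and apply Hölder's inequality to the last term. -/
theorem lintegral_le_quantile_add [IsProbabilityMeasure P] (hA : Measurable A)
    (hA0 : ∀ ω, 0 ≤ A ω) (hK : 0 < K) (hp : 1 < p)
    (hU : ∫⁻ ω, ENNReal.ofReal (A ω ^ p) ∂P ≠ ∞) :
    ∫⁻ ω, ENNReal.ofReal (A ω) ∂P ≤ ENNReal.ofReal (quantile P A K p) +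
      (∫⁻ ω, ENNReal.ofReal (A ω ^ p) ∂P) ^ p⁻¹ *
        ENNReal.ofReal (level K p) ^ (1 - p⁻¹) := by
  have hp0 : 0 < p := by linarith
  have hr : 0 < 1 - p⁻¹ := sub_pos.2 (inv_lt_one_of_one_lt₀ hp)
  set t₀ := quantile P A K p with ht₀
  let s := {ω | t₀ < A ω}
  have hs : MeasurableSet s := measurableSet_lt measurable_const hA
  calc ∫⁻ ω, ENNReal.ofReal (A ω) ∂P
      ≤ ∫⁻ ω, ENNReal.ofReal t₀ +
          ENNReal.ofReal (A ω ^ p) ^ p⁻¹ * (s.indicator 1 ω) ^ (1 - p⁻¹) ∂P := by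
        refine lintegral_mono fun ω => ?_
        by_cases h : ω ∈ s
        · refine le_trans ?_ le_add_self
          rw [← ENNReal.ofReal_rpow_of_nonneg (hA0 ω) hp0.le, ENNReal.rpow_rpow_inv hp0.ne']
          simp [h]
        · refine le_trans (ENNReal.ofReal_le_ofReal ?_) le_self_add
          exact not_lt.1 h
    _ = ENNReal.ofReal t₀ +
          ∫⁻ ω, ENNReal.ofReal (A ω ^ p) ^ p⁻¹ * (s.indicator 1 ω) ^ (1 - p⁻¹) ∂P := by
        rw [lintegral_add_left measurable_const]; simp
    _ ≤ ENNReal.ofReal t₀ + (∫⁻ ω, ENNReal.ofReal (A ω ^ p) ∂P) ^ p⁻¹ *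
          (∫⁻ ω, s.indicator 1 ω ∂P) ^ (1 - p⁻¹) := by
        gcongr
        exact ENNReal.lintegral_mul_norm_pow_le (by fun_prop)
          (measurable_one.indicator hs).aemeasurable (by positivity) hr.le (by ring)
    _ ≤ _ := by
        rw [lintegral_indicator_one hs]
        gcongr
        exact measure_quantile_lt_le hA hK hp hU

/-- This identity dictates the level: `K^p 2^(p-1)` is the factor in front of `E A^p * level^(p-1)`.
-/
theorem rpow_mul_level_rpow (hK : 0 < K) (hp : 1 < p) :
    ENNReal.ofReal K ^ p * (2 ^ (p - 1) * ENNReal.ofReal (level K p) ^ (p - 1)) =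
      ENNReal.ofReal (1 / 4) := by
  have hp0 : 0 < p := by linarith
  have hr : 0 < p - 1 := by linarith
  rw [show (2 : ℝ≥0∞) = ENNReal.ofReal 2 by simp, ENNReal.ofReal_rpow_of_pos hK,
    ENNReal.ofReal_rpow_of_pos (by norm_num), ENNReal.ofReal_rpow_of_pos (level_pos hK),
    ← ENNReal.ofReal_mul (by positivity), ← ENNReal.ofReal_mul (by positivity)]
  congr 1
  unfold level
  rw [Real.div_rpow zero_le_one (by positivity), Real.one_rpow,
    Real.mul_rpow (by positivity) (by positivity), ← Real.rpow_mul (by norm_num),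
    ← Real.rpow_mul hK.le, div_mul_cancel₀ _ hr.ne', div_mul_cancel₀ _ hr.ne',
    show p + 1 = (p - 1) + 2 by ring, Real.rpow_add (by norm_num)]
  have h1 : K ^ p ≠ 0 := by positivity
  have h2 : (2 : ℝ) ^ (p - 1) ≠ 0 := by positivity
  field_simp
  norm_num

theorem le_two_mul_of_le_add {U a : ℝ≥0∞} (hU : U ≠ ∞)
    (h : U ≤ a + ENNReal.ofReal (1 / 4) * U) : U ≤ 2 * a := by
  rcases eq_or_ne a ∞ with rfl | ha
  · simp
  rw [← ENNReal.toReal_le_toReal hU (ENNReal.mul_ne_top (by simp) ha)]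
  rw [← ENNReal.toReal_le_toReal hU
    (ENNReal.add_ne_top.2 ⟨ha, ENNReal.mul_ne_top ENNReal.ofReal_ne_top hU⟩),
    ENNReal.toReal_add ha (ENNReal.mul_ne_top ENNReal.ofReal_ne_top hU), ENNReal.toReal_mul,
    ENNReal.toReal_ofReal (by norm_num)] at h
  rw [ENNReal.toReal_mul, ENNReal.toReal_ofNat]
  have : 0 ≤ U.toReal := ENNReal.toReal_nonneg
  linarith

/-- The mean in a moment inequality can be replaced by the quantile. -/
theorem lintegral_rpow_le_of_le_mean [IsProbabilityMeasure P] (hA : Measurable A)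
    (hA0 : ∀ ω, 0 ≤ A ω) (hK : 0 < K) (hp : 1 < p)
    (hU : ∫⁻ ω, ENNReal.ofReal (A ω ^ p) ∂P ≠ ∞) {R : ℝ≥0∞}
    (h : ∫⁻ ω, ENNReal.ofReal (A ω ^ p) ∂P ≤
      ENNReal.ofReal K ^ p * ((∫⁻ ω, ENNReal.ofReal (A ω) ∂P) ^ p + R)) :
    ∫⁻ ω, ENNReal.ofReal (A ω ^ p) ∂P ≤ ENNReal.ofReal ((4 * K) ^ p) *
      (ENNReal.ofReal (2 ^ (1 + p) * quantile P A K p ^ p) + R) := by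
  have hp0 : 0 < p := by linarith
  have hE := lintegral_le_quantile_add hA hA0 hK hp hU
  set U := ∫⁻ ω, ENNReal.ofReal (A ω ^ p) ∂P
  set L := ENNReal.ofReal (level K p)
  set T := ENNReal.ofReal (quantile P A K p) with hT
  set k := ENNReal.ofReal K with hk
  have hEp : (∫⁻ ω, ENNReal.ofReal (A ω) ∂P) ^ p ≤
      2 ^ (p - 1) * (T ^ p + U * L ^ (p - 1)) := by
    refine (ENNReal.rpow_le_rpow hE hp0.le).trans ?_
    refine (ENNReal.rpow_add_le_mul_rpow_add_rpow _ _ hp.le).trans_eq ?_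
    rw [ENNReal.mul_rpow_of_nonneg _ _ hp0.le, ENNReal.rpow_inv_rpow hp0.ne',
      ← ENNReal.rpow_mul, sub_mul, one_mul, inv_mul_cancel₀ hp0.ne']
  have h1 : U ≤ k ^ p * (2 ^ (p - 1) * T ^ p + R) + ENNReal.ofReal (1 / 4) * U := by
    rw [← rpow_mul_level_rpow hK hp]
    calc U ≤ k ^ p * (2 ^ (p - 1) * (T ^ p + U * L ^ (p - 1)) + R) := h.trans (by gcongr)
      _ = _ := by ring
  have h2 : 2 * k ^ p ≤ ENNReal.ofReal ((4 * K) ^ p) := by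
    rw [← ENNReal.ofReal_rpow_of_pos (by positivity), ENNReal.ofReal_mul (by norm_num),
      ENNReal.mul_rpow_of_nonneg _ _ hp0.le]
    gcongr
    calc (2 : ℝ≥0∞) ≤ 4 ^ (1 : ℝ) := by norm_num
      _ ≤ ENNReal.ofReal 4 ^ p := by
        rw [ENNReal.ofReal_ofNat]
        exact ENNReal.rpow_le_rpow_of_exponent_le (by norm_num) hp.le
  calc U ≤ 2 * (k ^ p * (2 ^ (p - 1) * T ^ p + R)) := le_two_mul_of_le_add hU h1
    _ = 2 * k ^ p * (2 ^ (p - 1) * T ^ p + R) := by ring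
    _ ≤ ENNReal.ofReal ((4 * K) ^ p) * (2 ^ (1 + p) * T ^ p + R) := by
      gcongr
      · norm_num
      · linarith
    _ = _ := by
      rw [ENNReal.ofReal_mul (p := 2 ^ (1 + p)) (by positivity),
        ← ENNReal.ofReal_rpow_of_pos (x := 2) (by norm_num),
        ← ENNReal.ofReal_rpow_of_nonneg quantile_nonneg hp0.le, ENNReal.ofReal_ofNat]

end Quantile

/-! ### From random variables to the product of their laws -/

section Array

variable {Ω : Type u} {S : Type v} [MeasurableSpace Ω] [MeasurableSpace S] {m n : ℕ}
  {P : Measure Ω} {X : Fin m × Fin n → Ω → S}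
  {h : (Fin m → Fin n) → (Fin m → S) → ℝ} {p : ℝ}

theorem measurable_select (i : Fin m → Fin n) :
    Measurable (select i : (Fin m × Fin n → S) → Fin m → S) :=
  measurable_pi_lambda _ fun _ => measurable_pi_apply _

/-- The kernels, as functions of the whole array. -/
noncomputable def kernel (h : (Fin m → Fin n) → (Fin m → S) → ℝ) (i : Fin m → Fin n)
    (x : Fin m × Fin n → S) : ℝ≥0∞ :=
  ENNReal.ofReal (h i (select i x))

theorem measurable_kernel (hh : ∀ i, Measurable (h i)) (i : Fin m → Fin n) :
    Measurable (kernel h i) :=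
  ((hh i).comp (measurable_select i)).ennreal_ofReal

omit [MeasurableSpace S] in
theorem dependsOnSelected_kernel (I : Finset (Fin m)) :
    DependsOnSelected (kernel h) I := by
  intro i x y hxy
  have : select i x = select i y := funext fun j => hxy (j, i j) (by simp)
  simp [kernel, this]

omit [MeasurableSpace Ω] [MeasurableSpace S] in
theorem ofReal_stat (h0 : ∀ i x, 0 ≤ h i x) (ω : Ω) :
    ENNReal.ofReal (stat h X ω) = ∑ i, kernel h i fun a => X a ω :=
  ENNReal.ofReal_sum_of_nonneg fun i _ => h0 i _

omit [MeasurableSpace Ω] [MeasurableSpace S] in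
theorem stat_nonneg (h0 : ∀ i x, 0 ≤ h i x) (ω : Ω) : 0 ≤ stat h X ω :=
  Finset.sum_nonneg fun i _ => h0 i _

omit [MeasurableSpace Ω] [MeasurableSpace S] in
theorem ofReal_stat_rpow (h0 : ∀ i x, 0 ≤ h i x) (hp : 0 ≤ p) (ω : Ω) :
    ENNReal.ofReal (stat h X ω ^ p) = (∑ i, kernel h i fun a => X a ω) ^ p := by
  rw [← ofReal_stat h0, ENNReal.ofReal_rpow_of_nonneg (stat_nonneg h0 ω) hp]

theorem measurable_stat (hX : ∀ a, Measurable (X a)) (hh : ∀ i, Measurable (h i)) :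
    Measurable (stat h X) :=
  Finset.measurable_sum _ fun i _ =>
    (hh i).comp ((measurable_select i).comp (measurable_pi_lambda _ hX))

theorem lintegral_stat_rpow_ne_top (hX : ∀ a, Measurable (X a)) (hh : ∀ i, Measurable (h i))
    (h0 : ∀ i x, 0 ≤ h i x) (hp : 1 < p)
    (hint : ∀ i, Integrable (fun x => h i x ^ p) (P.map fun ω => select i fun a => X a ω)) :
    ∫⁻ ω, ENNReal.ofReal (stat h X ω ^ p) ∂P ≠ ∞ := by
  have hp0 : 0 < p := by linarith
  have hXm : Measurable fun ω a => X a ω := measurable_pi_lambda _ hX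
  have hk : ∀ i, Measurable fun ω => kernel h i (fun a => X a ω) ^ p := fun i =>
    ((measurable_kernel hh i).comp hXm).pow_const p
  simp only [ofReal_stat_rpow h0 hp0.le]
  refine ne_top_of_le_ne_top ?_ (lintegral_mono fun ω =>
    ENNReal.rpow_sum_le_const_mul_sum_rpow Finset.univ _ hp.le)
  rw [lintegral_const_mul _ (Finset.measurable_sum _ fun i _ => hk i),
    lintegral_finsetSum _ fun i _ => hk i]
  refine ENNReal.mul_ne_top (ENNReal.rpow_ne_top_of_nonneg (by linarith) (by simp)) ?_
  refine ENNReal.sum_ne_top.2 fun i _ => ?_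
  have h1 := (hint i).lintegral_lt_top
  rw [lintegral_map (g := fun ω => select i fun a => X a ω) (by have := hh i; fun_prop)
    ((measurable_select i).comp hXm)] at h1
  convert! h1.ne using 3 with ω
  rw [kernel, ENNReal.ofReal_rpow_of_nonneg (h0 i _) hp0.le]

variable [IsProbabilityMeasure P]

theorem isProbabilityMeasure_map (hX : ∀ a, Measurable (X a)) (a : Fin m × Fin n) :
    IsProbabilityMeasure (P.map (X a)) :=
  Measure.isProbabilityMeasure_map (hX a).aemeasurable

theorem lintegral_array (hX : ∀ a, Measurable (X a)) (hi : iIndepFun X P) {J : Finset (Fin m)}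
    {f : (Fin m × Fin n → S) → ℝ≥0∞} (hf : Measurable f) (hd : DependsOn f {a | a.1 ∈ J})
    (x : Fin m × Fin n → S) :
    ∫⁻ ω, f (fun a => X a ω) ∂P = lmarginal (fun a => P.map (X a)) (block n J) f x := by
  have := isProbabilityMeasure_map (P := P) hX
  have h1 : P.map (fun ω a => X a ω) = Measure.pi fun a => P.map (X a) :=
    (iIndepFun_iff_map_fun_eq_pi_map fun a => (hX a).aemeasurable).1 hi
  rw [← lintegral_map hf (measurable_pi_lambda _ hX), h1, lintegral_eq_lmarginal_univ x,
    show (Finset.univ : Finset (Fin m × Fin n)) = block n (J ∪ Jᶜ) by ext a; simp,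
    lmarginal_block_union hf disjoint_compl_right,
    lmarginal_of_dependsOn (s := block n Jᶜ) hd (by simp)]

theorem measurable_innerSum (hX : ∀ a, Measurable (X a)) (hh : ∀ i, Measurable (h i))
    (J : Finset (Fin m)) (a : J → Fin n) : Measurable (innerSum P X h J a) := by
  have := isProbabilityMeasure_map (P := P) hX
  exact Finset.measurable_sum _ fun i _ => (measurable_kernel hh i).lmarginal _

omit [IsProbabilityMeasure P] in
theorem innerSum_le (hh : ∀ i, Measurable (h i)) (J : Finset (Fin m)) (a : J → Fin n)
    (x : Fin m × Fin n → S) :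
    innerSum P X h J a x ≤
      lmarginal (fun a => P.map (X a)) (block n Jᶜ) (fun y => ∑ i, kernel h i y) x := by
  rw [lmarginal_finsetSum _ _ (measurable_kernel hh)]
  exact Finset.sum_le_sum_of_subset (Finset.filter_subset _ _)

omit [IsProbabilityMeasure P] in
theorem dependsOn_lmarginal_compl (J : Finset (Fin m)) (f : (Fin m × Fin n → S) → ℝ≥0∞) :
    DependsOn (lmarginal (fun a => P.map (X a)) (block n Jᶜ) f) {a | a.1 ∈ J} :=
  fun _ _ hxy => lmarginal_congr _ f fun a ha => hxy a (by simpa using ha)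

theorem maxMoment_eq (hX : ∀ a, Measurable (X a)) (hi : iIndepFun X P)
    (hh : ∀ i, Measurable (h i)) (J : Finset (Fin m)) (x : Fin m × Fin n → S) :
    maxMoment P X h p J = lmarginal (fun a => P.map (X a)) (block n J)
      (fun y => ⨆ a : J → Fin n, innerSum P X h J a y ^ p) x := by
  refine lintegral_array hX hi
    (Measurable.iSup fun a => (measurable_innerSum hX hh J a).pow_const p) ?_ x
  refine fun y z hyz => iSup_congr fun a => ?_
  congr 1
  exact Finset.sum_congr rfl fun i _ => dependsOn_lmarginal_compl J _ hyz

/-- Nonnegativity lets the inner sum be extended to all indices, which removes the maximum; Jensen's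
inequality for `E_{Jᶜ}` does the rest. -/
theorem maxMoment_le (hX : ∀ a, Measurable (X a)) (hi : iIndepFun X P)
    (hh : ∀ i, Measurable (h i)) (h0 : ∀ i x, 0 ≤ h i x) (hp : 1 < p) (J : Finset (Fin m)) :
    maxMoment P X h p J ≤ ∫⁻ ω, ENNReal.ofReal (stat h X ω ^ p) ∂P := by
  have := isProbabilityMeasure_map (P := P) hX
  have hp0 : 0 < p := by linarith
  obtain ⟨ω₀⟩ : Nonempty Ω := P.nonempty_of_neZero
  have hF : Measurable fun y : Fin m × Fin n → S => ∑ i, kernel h i y :=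
    Finset.measurable_sum _ fun i _ => measurable_kernel hh i
  have hFp := hF.pow_const p
  rw [maxMoment_eq hX hi hh J fun a => X a ω₀]
  calc _ ≤ lmarginal (fun a => P.map (X a)) (block n J)
        (lmarginal (fun a => P.map (X a)) (block n Jᶜ) fun y => (∑ i, kernel h i y) ^ p)
        fun a => X a ω₀ := by
        refine lmarginal_mono (fun y => iSup_le fun a => ?_) _
        exact (ENNReal.rpow_le_rpow (innerSum_le hh J a y) hp0.le).trans
          (rpow_lmarginal_le _ hF hp.le y)
    _ = ∫⁻ ω, (∑ i, kernel h i fun a => X a ω) ^ p ∂P := by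
        rw [← lmarginal_block_union hFp disjoint_compl_right,
          Finset.union_compl, lintegral_array hX hi (J := Finset.univ) hFp]
        exact fun y z hyz => by rw [show y = z from funext fun a => hyz a (by simp)]
    _ = _ := by simp only [ofReal_stat_rpow h0 hp0.le]

theorem lmarginal_condMax_rpow_le (hX : ∀ a, Measurable (X a)) (hi : iIndepFun X P)
    (hh : ∀ i, Measurable (h i)) (hp : 1 < p) (J : Finset (Fin m)) (c : Fin m → Fin n)
    (x : Fin m × Fin n → S) :
    lmarginal (fun a => P.map (X a)) (block n J)
      (fun y => condMax (fun a => P.map (X a)) (kernel h) c Finset.univ J y ^ p) x ≤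
      maxMoment P X h p J := by
  have hp0 : 0 < p := by linarith
  rw [maxMoment_eq hX hi hh J x]
  refine lmarginal_mono (fun y => ?_) x
  rw [← iSup_rpow _ hp0]
  refine ENNReal.rpow_le_rpow (iSup₂_le fun b _ => ?_) hp0.le
  refine le_iSup_of_le (J.restrict b) ?_
  refine (Finset.sum_congr ?_ fun i _ => ?_).le
  · ext i
    simp [funext_iff, Finset.restrict]
  · rw [← Finset.compl_eq_univ_sdiff]
    rfl

/-- The moment inequality in terms of the mean. -/
theorem lintegral_stat_rpow_le (hX : ∀ a, Measurable (X a)) (hi : iIndepFun X P)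
    (hh : ∀ i, Measurable (h i)) (h0 : ∀ i x, 0 ≤ h i x) (hp : 1 < p) :
    ∫⁻ ω, ENNReal.ofReal (stat h X ω ^ p) ∂P ≤
      momentConst m ^ p * ((∫⁻ ω, ENNReal.ofReal (stat h X ω) ∂P) ^ p +
        ∑ J : Finset (Fin m) with J.Nonempty,
          ENNReal.ofReal (p ^ ((J.card : ℝ) * p)) * maxMoment P X h p J) := by
  have := isProbabilityMeasure_map (P := P) hX
  have hp0 : 0 < p := by linarith
  simp only [ofReal_stat_rpow h0 hp0.le, ofReal_stat h0]
  -- The induction needs a base multi-index `c`; there is none when `n = 0 < m`, and then the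
  -- statistic is zero.
  rcases isEmpty_or_nonempty (Fin m → Fin n) with hc | ⟨⟨c⟩⟩
  · simp [hp0]
  obtain ⟨ω₀⟩ : Nonempty Ω := P.nonempty_of_neZero
  let x : Fin m × Fin n → S := fun a => X a ω₀
  have hF : Measurable fun y : Fin m × Fin n → S => ∑ i, kernel h i y :=
    Finset.measurable_sum _ fun i _ => measurable_kernel hh i
  have huniv : agree Finset.univ c = Finset.univ := by ext i; simp
  have hdep : ∀ f : (Fin m × Fin n → S) → ℝ≥0∞,
      DependsOn f {a | a.1 ∈ (Finset.univ : Finset (Fin m))} := fun f y z hyz => by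
    rw [show y = z from funext fun a => hyz a (by simp)]
  have hmain := lmarginal_sum_agree_rpow_le (μ := fun a => P.map (X a)) hp Finset.univ
    (kernel h) (measurable_kernel hh) (dependsOnSelected_kernel _) c x
  rw [huniv, Finset.card_univ, Fintype.card_fin,
    ← lintegral_array hX hi (hF.pow_const p) (hdep _) x] at hmain
  refine hmain.trans ?_
  gcongr
  rw [momentSum, Finset.powerset_univ,
    ← Finset.sum_filter_not_add_sum_filter Finset.univ fun J : Finset (Fin m) => J.Nonempty]
  refine add_le_add ?_ (Finset.sum_le_sum fun J _ => ?_)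
  -- The set `J = ∅` has weight 1 and contributes the mean.
  · have : (Finset.univ.filter fun J : Finset (Fin m) => ¬ J.Nonempty) = {∅} := by
      ext J; simp [Finset.not_nonempty_iff_eq_empty]
    rw [this, Finset.sum_singleton, lintegral_array hX hi hF (hdep _) x]
    simp only [Finset.card_empty, Nat.cast_zero, zero_mul, ENNReal.rpow_zero, one_mul, block,
      Finset.empty_product, lmarginal_empty]
    refine ENNReal.rpow_le_rpow ?_ hp0.le
    refine (condMax_le (measurable_kernel hh) (Finset.empty_subset _) x).trans_eq ?_
    rw [huniv, Finset.sdiff_empty]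
    rfl
  · rw [← ENNReal.ofReal_rpow_of_pos hp0]
    gcongr
    exact lmarginal_condMax_rpow_le hX hi hh hp J c x

end Array

end UStat

theorem theorem2p3 (m : ℕ) :
    ∃ K : ℝ, 0 < K ∧
      ∀ (n : ℕ) (p : ℝ) (Ω : Type u) (S : Type v) [MeasurableSpace Ω] [MeasurableSpace S]
        (P : Measure Ω) [IsProbabilityMeasure P]
        (X : Fin m × Fin n → Ω → S) (h : (Fin m → Fin n) → (Fin m → S) → ℝ),
        1 < p →
        (∀ a, Measurable (X a)) →
        iIndepFun X P →
        (∀ i, Measurable (h i)) →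
        (∀ i x, 0 ≤ h i x) →
        (∀ i, Integrable (fun x => h i x ^ p)
          (P.map fun ω => UStat.select i fun a => X a ω)) →
        (ENNReal.ofReal
              (1 / (4 * K) ^ (p / (p - 1)) * UStat.quantile P (UStat.stat h X) K p ^ p) ⊔
            ⨆ (J : Finset (Fin m)) (_ : J.Nonempty), UStat.maxMoment P X h p J
          ≤ ∫⁻ ω, ENNReal.ofReal (UStat.stat h X ω ^ p) ∂P) ∧
        (∫⁻ ω, ENNReal.ofReal (UStat.stat h X ω ^ p) ∂P
          ≤ ENNReal.ofReal ((4 * K) ^ p) *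
            (ENNReal.ofReal (2 ^ (1 + p) * UStat.quantile P (UStat.stat h X) K p ^ p) +
              ∑ J : Finset (Fin m) with J.Nonempty,
                ENNReal.ofReal (p ^ ((J.card : ℝ) * p)) * UStat.maxMoment P X h p J)) := by
  have hK : 0 < (UStat.momentConst m).toReal :=
    ENNReal.toReal_pos (zero_lt_one.trans_le (UStat.one_le_momentConst m)).ne'
      (UStat.momentConst_ne_top m)
  refine ⟨(UStat.momentConst m).toReal, hK, ?_⟩
  intro n p Ω S _ _ P _ X h hp hX hi hh h0 hint
  have hA := UStat.measurable_stat hX hh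
  have hU := UStat.lintegral_stat_rpow_ne_top hX hh h0 hp hint
  refine ⟨sup_le ?_ (iSup₂_le fun J _ => UStat.maxMoment_le hX hi hh h0 hp J), ?_⟩
  · refine le_trans (ENNReal.ofReal_le_ofReal ?_)
      (UStat.level_mul_quantile_rpow_le hA hK hp hU)
    exact mul_le_mul_of_nonneg_right (UStat.one_div_rpow_le_level hK hp)
      (Real.rpow_nonneg UStat.quantile_nonneg p)
  · refine UStat.lintegral_rpow_le_of_le_mean hA (UStat.stat_nonneg h0) hK hp hU ?_
    rw [ENNReal.ofReal_toReal (UStat.momentConst_ne_top m)]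
    exact UStat.lintegral_stat_rpow_le hX hi hh h0 hp
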